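/- **Conventions.** $D$ denotes a C*-algebra and $\mathcal E$ a (right) Hilbert $D$-module, with inner product linear in the second variable. A representation of a C*-algebra $B$ on $\mathcal E$ is a nondegenerate $*$-homomorphism $B\to\mathbb B(\mathcal E)$ into the adjointable operators. A correspondence from $D_1$ to $D_2$ is a Hilbert $D_2$-module with a representation of $D_1$. Let $A$ be a unital $*$-algebra. A representation of $A$ on $\mathcal E$ is a pair $(\mathfrak E,\pi)$ of a dense $D$-submodule $\mathfrak E\subseteq\mathcal E$ and a unital homomorphism $\pi\colon A\to\mathrm{End}_D(\mathfrak E)$ with $\langle\pi(a)\xi,\eta\rangle=\langle\xi,\pi(a^*)\eta\rangle$ for $a\in A$, $\xi,\eta\in\mathfrak E$. It is closed if $\mathfrak E$ is complete in the graph topology, which is generated by the norms $\|\langle\xi,\xi\rangle+\langle\pi(a)\xi,\pi(a)\xi\rangle\|^{1/2}$ for $a\in A$; its closure is its extension to the completion of $\mathfrak E$ in this topology, which is a subspace of $\mathcal E$. For a correspondence $\mathcal F$ from $D$ to $D'$, $(\mathfrak E,\pi)\otimes_D 1_{\mathcal F}$ is the closure of the representation $a\mapsto\pi(a)\otimes 1$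 on the image of $\mathfrak E\odot\mathcal F$ in the interior tensor product $\mathcal E\otimes_D\mathcal F$. An isometry is a $D$-linear, inner product preserving (not necessarily adjointable) map. An isometry $I\colon\mathcal E_1\to\mathcal E_2$ intertwines $(\mathfrak E_1,\pi_1)$ and $(\mathfrak E_2,\pi_2)$ if $I(\mathfrak E_1)\subseteq\mathfrak E_2$ and $I\pi_1(a)\xi=\pi_2(a)I\xi$ for $a\in A$, $\xi\in\mathfrak E_1$; it intertwines representations $\varrho_1,\varrho_2$ of $B$ if $I\varrho_1(b)=\varrho_2(b)I$ for all $b\in B$. A densely defined operator $t$ on $\mathcal E$ is regular if it is closed, its adjoint is densely defined, and $1+t^*t$ has dense range; it is self-adjoint if $t=t^*$. Powers of operators have their natural domains. Let $A=\mathbb C[x]$ with $x=x^*$ and $B=C_0(\mathbb R)$. Let $\mathfrak B=\{f\in B : x^nf\in B\text{ for all }n\in\mathbb N\}$ and let $\mu(p)f=p\cdot f$ for $p\in A$, $f\in\mathfrak B$; this is a representation of $A$ on the Hilbert $B$-module $B$. For a representation $\varrho$ of $B$ on $\mathcal E$, let $\Phi(\varrho)=\mu\otimes_\varrho 1_{\mathcal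 E}$, viewed as a representation of $A$ on $\mathcal E$ through the unitary $B\otimes_\varrho\mathcal E\cong\mathcal E$, $b\otimes\xi\mapsto\varrho(b)\xi$. **Theorem.** Let $(\mathfrak E,\pi)$ be a closed representation of $A=\mathbb C[x]$ on a Hilbert module $\mathcal E$ over a C*-algebra $D$. The following are equivalent: 1. $\pi=\mu\otimes_\varrho1_{\mathcal E}$ for a representation $\varrho\colon C_0(\mathbb R)\to\mathbb B(\mathcal E)$; 2. $\overline{\pi(a)}$ is regular and self-adjoint for each $a\in A$ with $a=a^*$; 3. $\overline{\pi(x^n)}$ is regular and self-adjoint for each $n\in\mathbb N$; 4. $\overline{\pi(x)}$ is regular and self-adjoint and $\overline{\pi(x^n)}=\overline{\pi(x)}^{\,n}$ for all $n\in\mathbb N$; 5. $\overline{\pi(x)}$ is regular and self-adjoint and $\mathfrak E=\bigcap_{n=1}^\infty\operatorname{dom}\overline{\pi(x)}^{\,n}$. Call closed representations with these equivalent properties integrable. Then $C_0(\mathbb R)$, with the maps $\Phi$, is a C*-hull for the integrable representations of $\mathbb C[x]$, with $(\mathfrak B,\mu)$ as universal integrable representation. That is: * for every C*-algebra $D$ and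 every Hilbert $D$-module $\mathcal E$, $\Phi$ is a bijection from the representations of $C_0(\mathbb R)$ on $\mathcal E$ onto the integrable representations of $\mathbb C[x]$ on $\mathcal E$; * an isometry $\mathcal E_1\to\mathcal E_2$ of Hilbert $D$-modules intertwines two representations $\varrho_1,\varrho_2$ of $C_0(\mathbb R)$ if and only if it intertwines $\Phi(\varrho_1)$ and $\Phi(\varrho_2)$; * if $\mathcal F$ is a correspondence from $D_1$ to $D_2$ and $\varrho$ is a representation of $C_0(\mathbb R)$ on a Hilbert $D_1$-module $\mathcal E$, then $\Phi(\varrho\otimes_{D_1}1_{\mathcal F})=\Phi(\varrho)\otimes_{D_1}1_{\mathcal F}$ on $\mathcal E\otimes_{D_1}\mathcal F$; * $\Phi$ maps the identity representation of $C_0(\mathbb R)$ on itself to $(\mathfrak B,\mu)$. -/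

import Mathlib

open scoped RightActions ZeroAtInfty Polynomial
open Filter Topology

universe u v w u₁ u₂ v₁ v₂ v₃

/-- A right Hilbert `D`-module structure on a complex normed space `E`.  The inner product is
`D`-valued, conjugate-linear in the first and linear in the second variable; the right action of
`d : D` on `x : E` is written `x <• d`.  Completeness is assumed separately as `CompleteSpace E`. -/
class HilbertModule (D : Type u) (E : Type v) [NonUnitalCStarAlgebra D]
    [NormedAddCommGroup E] [NormedSpace ℂ E] extends SMul Dᵐᵒᵖ E, Inner D E where
  add_rsmul (x y : E) (d : D) : (x + y) <• d = x <• d + y <• d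
  rsmul_add (x : E) (d e : D) : x <• (d + e) = x <• d + x <• e
  rsmul_mul (x : E) (d e : D) : x <• (d * e) = (x <• d) <• e
  smul_rsmul (z : ℂ) (x : E) (d : D) : (z • x) <• d = z • (x <• d)
  rsmul_smul (z : ℂ) (x : E) (d : D) : x <• (z • d) = z • (x <• d)
  inner_add_right (x y z : E) : inner x (y + z) = inner x y + inner x z
  inner_smul_right (z : ℂ) (x y : E) : inner x (z • y) = z • inner x y
  inner_rsmul_right (x y : E) (d : D) : inner x (y <• d) = inner x y * d
  star_inner (x y : E) : star (inner x y) = inner y x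
  /-- The inner product `⟨x, x⟩` is a positive element of `D`. -/
  inner_self_nonneg (x : E) : ∃ d : D, inner x x = star d * d
  norm_sq_eq (x : E) : ‖x‖ ^ 2 = ‖inner x x‖

namespace HilbertModule

section basic

variable {D : Type u} {E : Type v} [NonUnitalCStarAlgebra D]
  [NormedAddCommGroup E] [NormedSpace ℂ E] [HilbertModule D E]

theorem inner_add_left (x y z : E) : inner D (x + y) z = inner D x z + inner D y z := by
  rw [← star_inner z (x + y), inner_add_right, star_add, star_inner, star_inner]

theorem inner_smul_left (c : ℂ) (x y : E) : inner D (c • x) y = star c • inner D x y := by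
  rw [← star_inner y (c • x), inner_smul_right, star_smul, star_inner]

theorem inner_rsmul_left (x y : E) (d : D) : inner D (x <• d) y = star d * inner D x y := by
  rw [← star_inner y (x <• d), inner_rsmul_right, star_mul, star_inner]

theorem norm_inner_le (x y : E) : ‖inner D x y‖ ≤ ‖x‖ * ‖y‖ := by
  let _ := CStarAlgebra.spectralOrder Dᵐᵒᵖ
  have := CStarAlgebra.spectralOrderedRing Dᵐᵒᵖ
  let _ : CStarModule Dᵐᵒᵖ E :=
    { inner := fun x y => MulOpposite.op (inner D x y)
      inner_add_right := by intro x y z; simp [inner_add_right]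
      inner_self_nonneg := by
        intro x
        obtain ⟨d, hd⟩ := inner_self_nonneg (D := D) x
        rw [hd, MulOpposite.op_mul, MulOpposite.op_star]
        exact mul_star_self_nonneg _
      inner_self := by
        intro x
        rw [MulOpposite.op_eq_zero_iff, ← norm_eq_zero, ← norm_sq_eq]
        simp
      inner_op_smul_right := by
        intro a x y
        have := inner_rsmul_right (D := D) x y a.unop
        rw [MulOpposite.op_unop] at this
        rw [this, MulOpposite.op_mul, MulOpposite.op_unop]
      inner_smul_right_complex := by intro z x y; simp [inner_smul_right]
      star_inner := by
        intro x y
        rw [← MulOpposite.op_star, star_inner]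
      norm_eq_sqrt_norm_inner_self := by
        intro x
        rw [MulOpposite.norm_op, ← norm_sq_eq, Real.sqrt_sq (norm_nonneg _)] }
  have := CStarModule.norm_inner_le (A := Dᵐᵒᵖ) E (x := x) (y := y)
  exact this

/-- The inner product as a continuous linear map in the second variable. -/
noncomputable def innerRight (x : E) : E →L[ℂ] D :=
  LinearMap.mkContinuous
    { toFun := fun y => inner D x y
      map_add' := inner_add_right x
      map_smul' := fun z y => inner_smul_right z x y } ‖x‖ (fun y => norm_inner_le x y)

theorem innerRight_apply (x y : E) : innerRight (D := D) x y = inner D x y := rfl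

theorem continuous_inner_right (x : E) : Continuous fun y => inner D x y :=
  (innerRight (D := D) x).continuous

theorem continuous_inner_left (y : E) : Continuous fun x => inner D x y := by
  simp_rw [← star_inner (D := D) y]
  exact (continuous_inner_right y).star

theorem inner_sub_right (x y z : E) : inner D x (y - z) = inner D x y - inner D x z :=
  (innerRight (D := D) x).map_sub y z

theorem eq_zero_of_inner_self {x : E} (h : inner D x x = 0) : x = 0 := by
  have := norm_sq_eq (D := D) x
  rw [h] at this
  simpa using this

theorem eq_zero_of_dense {S : Set E} (hS : Dense S) {x : E} (h : ∀ y ∈ S, inner D y x = 0) :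
    x = 0 := by
  apply eq_zero_of_inner_self (D := D)
  have : (fun y => inner D y x) = fun _ => (0 : D) :=
    (continuous_inner_left x).ext_on hS continuous_const h
  exact congrFun this x

theorem eq_of_dense {S : Set E} (hS : Dense S) {x y : E}
    (h : ∀ z ∈ S, inner D z x = inner D z y) : x = y := by
  rw [← sub_eq_zero]
  apply eq_zero_of_dense (D := D) hS
  intro z hz
  rw [inner_sub_right, h z hz, sub_self]

variable (E) in
theorem continuous_rsmul (d : D) : Continuous fun x : E => x <• d := by
  let L : E →ₗ[ℂ] E :=
    { toFun := fun x => x <• d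
      map_add' := fun x y => add_rsmul x y d
      map_smul' := fun z x => smul_rsmul z x d }
  refine AddMonoidHomClass.continuous_of_bound L ‖d‖ fun x => ?_
  refine (sq_le_sq₀ (norm_nonneg _) (by positivity)).1 ?_
  change ‖x <• d‖ ^ 2 ≤ _
  rw [norm_sq_eq (D := D), inner_rsmul_left, inner_rsmul_right, mul_pow, norm_sq_eq (D := D) x]
  calc ‖star d * (inner D x x * d)‖ ≤ ‖star d‖ * (‖inner D x x‖ * ‖d‖) :=
        (norm_mul_le _ _).trans (mul_le_mul_of_nonneg_left (norm_mul_le _ _) (norm_nonneg _))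
    _ = _ := by rw [norm_star]; ring

/-- If the orthogonal sum of `x` and `y` has the inner product of `z`, then `‖x‖ ≤ ‖z‖`. -/
theorem norm_le_of_inner_add {x y z : E} (h : inner D x x + inner D y y = inner D z z) :
    ‖x‖ ≤ ‖z‖ := by
  let _ := CStarAlgebra.spectralOrder D
  have := CStarAlgebra.spectralOrderedRing D
  refine (sq_le_sq₀ (norm_nonneg _) (norm_nonneg _)).1 ?_
  rw [norm_sq_eq (D := D), norm_sq_eq (D := D)]
  obtain ⟨d, hd⟩ := inner_self_nonneg (D := D) x
  obtain ⟨e, he⟩ := inner_self_nonneg (D := D) y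
  refine CStarAlgebra.norm_le_norm_of_nonneg_of_le (by rw [hd]; exact star_mul_self_nonneg d) ?_
  rw [← h, he]
  exact le_add_of_nonneg_right (star_mul_self_nonneg e)

end basic

/-- A C*-algebra as a Hilbert module over itself, with `⟨x, y⟩ = x* y`. -/
noncomputable instance self (D : Type u) [NonUnitalCStarAlgebra D] : HilbertModule D D where
  smul d x := x * d.unop
  inner x y := star x * y
  add_rsmul x y d := add_mul x y d
  rsmul_add x d e := mul_add x d e
  rsmul_mul x d e := (mul_assoc x d e).symm
  smul_rsmul z x d := smul_mul_assoc z x d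
  rsmul_smul z x d := mul_smul_comm z x d
  inner_add_right x y z := mul_add _ y z
  inner_smul_right z x y := mul_smul_comm z _ y
  inner_rsmul_right x y d := (mul_assoc _ y d).symm
  star_inner x y := by simp
  inner_self_nonneg x := ⟨x, rfl⟩
  norm_sq_eq x := by rw [CStarRing.norm_star_mul_self, sq]

end HilbertModule

/-- A representation of a C*-algebra `B` on a Hilbert `D`-module `E`: a nondegenerate
`*`-homomorphism from `B` to the adjointable operators on `E` (the adjoint of `ρ b` being
`ρ (star b)`).  A correspondence from `B` to `D` is a Hilbert `D`-module with such a
representation. -/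
structure CStarRep (B : Type w) (D : Type u) (E : Type v) [NonUnitalCStarAlgebra B]
    [NonUnitalCStarAlgebra D] [NormedAddCommGroup E] [NormedSpace ℂ E] [HilbertModule D E] where
  toHom : B →ₙₐ[ℂ] (E →L[ℂ] E)
  inner_map_left (b : B) (x y : E) : inner D (toHom b x) y = inner D x (toHom (star b) y)
  nondegenerate : Dense (Submodule.span ℂ {z : E | ∃ b x, toHom b x = z} : Set E)

namespace CStarRep

variable {B : Type w} {D : Type u} {E : Type v} [NonUnitalCStarAlgebra B]
    [NonUnitalCStarAlgebra D] [NormedAddCommGroup E] [NormedSpace ℂ E] [HilbertModule D E]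

theorem inner_map_right (ρ : CStarRep B D E) (b : B) (x y : E) :
    inner D x (ρ.toHom b y) = inner D (ρ.toHom (star b) x) y := by
  rw [ρ.inner_map_left, star_star]

theorem norm_map_le (ρ : CStarRep B D E) (b : B) (x : E) : ‖ρ.toHom b x‖ ≤ ‖b‖ * ‖x‖ := by
  have key : ∀ c : B, ‖c‖ < 1 → ‖ρ.toHom c x‖ ≤ ‖x‖ := by
    intro c hc
    let _ := CStarAlgebra.spectralOrder B
    have := CStarAlgebra.spectralOrderedRing B
    have hd : IsSelfAdjoint (star c * c) := IsSelfAdjoint.star_mul_self c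
    let g : ℝ → ℝ := fun t => 1 - √(1 - t)
    have hg : Continuous g := by fun_prop
    have hg0 : g 0 = 0 := by simp [g]
    let s : B := cfcₙ g (star c * c)
    have hs : star s = s := (IsSelfAdjoint.cfcₙ (f := g) (a := star c * c)).star_eq
    have hsd : s + s - s * s = star c * c := by
      have h1 : s + s - s * s = cfcₙ (fun t => g t + g t - g t * g t) (star c * c) := by
        rw [cfcₙ_sub _ _ _ (by fun_prop) (by simp [hg0]) (by fun_prop) (by simp [hg0]),
          cfcₙ_add _ _ _ (by fun_prop) (by simp [hg0]) (by fun_prop) (by simp [hg0]),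
          cfcₙ_mul _ _ _ (by fun_prop) (by simp [hg0]) (by fun_prop) (by simp [hg0])]
      rw [h1]
      conv_rhs => rw [← cfcₙ_id' ℝ (star c * c)]
      refine cfcₙ_congr fun t ht => ?_
      have h2 : ‖t‖ ≤ ‖star c * c‖ := 
        NonUnitalIsometricContinuousFunctionalCalculus.norm_quasispectrum_le (𝕜 := ℝ) _ ht
      rw [CStarRing.norm_star_mul_self] at h2
      have h3 : t ≤ 1 := (le_abs_self t).trans (h2.trans (by nlinarith [norm_nonneg c]))
      have h4 := Real.mul_self_sqrt (show 0 ≤ 1 - t by linarith)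
      simp only [g]
      linear_combination -h4
    refine HilbertModule.norm_le_of_inner_add (D := D) (y := x - ρ.toHom s x) ?_
    have e1 : inner D (ρ.toHom c x) (ρ.toHom c x) = inner D x (ρ.toHom (star c * c) x) := by
      rw [ρ.inner_map_left, map_mul]; rfl
    have e2 : inner D (x - ρ.toHom s x) (x - ρ.toHom s x)
        = inner D x x - inner D x (ρ.toHom (s + s - s * s) x) := by
      have a1 : inner D (x - ρ.toHom s x) (x - ρ.toHom s x)
          = inner D x (x - ρ.toHom s x) - inner D x (ρ.toHom s (x - ρ.toHom s x)) := by
        have : x - ρ.toHom s x = x + (-1 : ℂ) • ρ.toHom s x := by simp [sub_eq_add_neg]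
        conv_lhs => rw [this]
        rw [HilbertModule.inner_add_left, HilbertModule.inner_smul_left, ρ.inner_map_left, hs, ← this]
        simp [sub_eq_add_neg]
      rw [a1, map_sub ρ.toHom, map_add ρ.toHom, map_mul ρ.toHom]
      simp only [_root_.sub_apply, _root_.add_apply, map_sub,
        mul_apply_eq_comp, HilbertModule.inner_sub_right, HilbertModule.inner_add_right]
      abel
    rw [e1, e2, hsd]
    abel
  refine le_of_forall_pos_le_add fun ε hε => ?_
  have hx : 0 < ‖x‖ + 1 := by positivity
  set r : ℝ := ‖b‖ + ε / (‖x‖ + 1) with hr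
  have hr0 : 0 < r := by positivity
  have h1 := key (((r : ℂ)⁻¹) • b) (by
    rw [norm_smul, norm_inv, Complex.norm_real, Real.norm_of_nonneg hr0.le, inv_mul_lt_one₀ hr0, hr]
    have : 0 < ε / (‖x‖ + 1) := by positivity
    linarith)
  rw [map_smul, _root_.smul_apply, norm_smul, norm_inv, Complex.norm_real,
    Real.norm_of_nonneg hr0.le, inv_mul_le_iff₀ hr0, hr, add_mul] at h1
  refine h1.trans (add_le_add le_rfl ?_)
  rw [div_mul_eq_mul_div, div_le_iff₀ hx]
  nlinarith [norm_nonneg x]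

/-- The identity representation of a C*-algebra on itself, by left multiplication. -/
noncomputable def self (B : Type u) [NonUnitalCStarAlgebra B] : CStarRep B B B where
  toHom :=
    { toFun := fun b => ContinuousLinearMap.mul ℂ B b
      map_smul' := fun z b => by simp
      map_zero' := by simp
      map_add' := fun a b => by simp
      map_mul' := fun a b => by ext x; simp [mul_assoc] }
  inner_map_left b x y := by
    change star (b * x) * y = star x * (star b * y)
    rw [star_mul, mul_assoc]
  nondegenerate := by
    let _ := CStarAlgebra.spectralOrder B
    have := CStarAlgebra.spectralOrderedRing B
    intro x
    have h := (CStarAlgebra.increasingApproximateUnit B).tendsto_mul_right x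
    have := (CStarAlgebra.increasingApproximateUnit B).neBot
    exact mem_closure_of_tendsto h (Eventually.of_forall fun e =>
      Submodule.subset_span ⟨e, x, rfl⟩)

end CStarRep

/-- A representation of the unital `*`-algebra `A` on the Hilbert `D`-module `E` by unbounded
operators: a dense `D`-submodule `dom` of `E` with a unital algebra homomorphism from `A` to the
`D`-module endomorphisms of `dom` that is formally compatible with the involution.  It need not be
closed. -/
structure UnboundedRep (A : Type w) (D : Type u) (E : Type v) [Ring A] [StarRing A] [Algebra ℂ A]
    [NonUnitalCStarAlgebra D] [NormedAddCommGroup E] [NormedSpace ℂ E] [HilbertModule D E] where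
  dom : Submodule ℂ E
  dense_dom : Dense (dom : Set E)
  rsmul_mem : ∀ x ∈ dom, ∀ d : D, x <• d ∈ dom
  π : A →ₐ[ℂ] Module.End ℂ dom
  map_rsmul (a : A) (x : dom) (d : D) :
    (π a ⟨(x : E) <• d, rsmul_mem x x.2 d⟩ : E) = (π a x : E) <• d
  inner_map_left (a : A) (x y : dom) :
    inner D (π a x : E) (y : E) = inner D (x : E) (π (star a) y : E)

namespace UnboundedRep

section

variable {A : Type w} {D : Type u} {E : Type v} [Ring A] [StarRing A] [Algebra ℂ A]
    [NonUnitalCStarAlgebra D] [NormedAddCommGroup E] [NormedSpace ℂ E] [HilbertModule D E]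

/-- The operator `π a`, as a partially defined operator on `E` with domain `dom`. -/
def op (P : UnboundedRep A D E) (a : A) : E →ₗ.[ℂ] E := ⟨P.dom, P.dom.subtype.comp (P.π a)⟩

/-- The map `x ↦ (π a x)ₐ` from the domain to the product `∏ₐ E`.  The graph norm of `a` is
equivalent to `‖x‖ + ‖π a x‖`, and `π 1 x = x`; hence the graph topology on the domain, with its
uniform structure, is the one for which this map is an embedding. -/
def graphMap (P : UnboundedRep A D E) : P.dom →ₗ[ℂ] (A → E) :=
  LinearMap.pi fun a => P.dom.subtype.comp (P.π a)

/-- The representation is closed if its domain is complete in the graph topology. -/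
def IsClosed (P : UnboundedRep A D E) : Prop := IsComplete (Set.range P.graphMap)

/-- The completion of the domain in the graph topology, realised inside `∏ₐ E`. -/
def graphClosure (P : UnboundedRep A D E) : Submodule ℂ (A → E) :=
  (LinearMap.range P.graphMap).topologicalClosure

theorem graphMap_mem (P : UnboundedRep A D E) (x : P.dom) : P.graphMap x ∈ P.graphClosure :=
  Submodule.le_topologicalClosure _ ⟨x, rfl⟩

theorem graphClosure_induction (P : UnboundedRep A D E) {p : (A → E) → Prop}
    (hp : _root_.IsClosed {v | p v}) (h : ∀ x : P.dom, p (P.graphMap x)) :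
    ∀ v ∈ P.graphClosure, p v := by
  intro v hv
  have hv' : v ∈ _root_.closure (Set.range P.graphMap) := hv
  exact closure_minimal (by rintro _ ⟨x, rfl⟩; exact h x) hp hv'

theorem graphClosure_inner (P : UnboundedRep A D E) (a : A) :
    ∀ v ∈ P.graphClosure, ∀ w ∈ P.graphClosure,
      inner D (v a) (w 1) = inner D (v 1) (w (star a)) := by
  refine P.graphClosure_induction ?_ fun x => ?_
  · simp only [Set.ofPred_forall]
    refine isClosed_iInter fun w => isClosed_iInter fun _ => isClosed_eq ?_ ?_
    · exact (HilbertModule.continuous_inner_left _).comp (continuous_apply a)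
    · exact (HilbertModule.continuous_inner_left _).comp (continuous_apply 1)
  · refine P.graphClosure_induction (isClosed_eq ?_ ?_) fun y => ?_
    · exact (HilbertModule.continuous_inner_right _).comp (continuous_apply 1)
    · exact (HilbertModule.continuous_inner_right _).comp (continuous_apply _)
    · simpa [graphMap] using P.inner_map_left a x y

theorem graphClosure_eq_zero (P : UnboundedRep A D E) {v : A → E} (hv : v ∈ P.graphClosure)
    (h : v 1 = 0) : v = 0 := by
  ext a
  refine HilbertModule.eq_zero_of_dense (D := D) P.dense_dom fun y hy => ?_
  have := P.graphClosure_inner (star a) _ (P.graphMap_mem ⟨y, hy⟩) _ hv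
  rw [h, star_star] at this
  have h1 : P.graphMap ⟨y, hy⟩ 1 = y := by simp [graphMap]
  rw [h1] at this
  rw [← this, ← HilbertModule.innerRight_apply, map_zero]

/-- Evaluation at `1` identifies the completion with a subspace of `E`. -/
noncomputable def graphEquiv (P : UnboundedRep A D E) :
    P.graphClosure ≃ₗ[ℂ] P.graphClosure.map (LinearMap.proj (R := ℂ) (φ := fun _ : A => E) 1) :=
  LinearEquiv.ofBijective ((LinearMap.proj (R := ℂ) (φ := fun _ : A => E) 1).submoduleMap _)
    ⟨by
      rw [injective_iff_map_eq_zero]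
      intro v hv
      exact Subtype.ext (P.graphClosure_eq_zero v.2 (congrArg Subtype.val hv)),
    LinearMap.submoduleMap_surjective _ _⟩

theorem graphEquiv_apply (P : UnboundedRep A D E) (v : P.graphClosure) :
    (P.graphEquiv v : E) = v.1 1 := rfl

/-- The extension of the representation to the completion, `(b v) a = v (a b)`. -/
def graphRep (P : UnboundedRep A D E) : A →ₐ[ℂ] Module.End ℂ P.graphClosure :=
  AlgHom.ofLinearMap
    { toFun := fun b =>
        { toFun := fun v => ⟨fun a => v.1 (a * b), by
            refine P.graphClosure_induction (p := fun v => (fun a => v (a * b)) ∈ P.graphClosure)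
              ?_ ?_ v.1 v.2
            · exact (Submodule.isClosed_topologicalClosure _).preimage
                (continuous_pi fun a => continuous_apply (a * b))
            · intro x
              have : (fun a => P.graphMap x (a * b)) = P.graphMap (P.π b x) := by
                ext a; simp [graphMap]
              rw [this]
              exact P.graphMap_mem _⟩
          map_add' := fun v w => rfl
          map_smul' := fun z v => rfl }
      map_add' := fun b c => by
        ext v a
        refine P.graphClosure_induction (p := fun v => v (a * (b + c)) = v (a * b) + v (a * c))
          (isClosed_eq (by fun_prop) (by fun_prop)) (fun x => ?_) v.1 v.2
        simp [graphMap, mul_add]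
      map_smul' := fun z b => by
        ext v a
        refine P.graphClosure_induction (p := fun v => v (a * (z • b)) = z • v (a * b))
          (isClosed_eq (by fun_prop) (by fun_prop)) (fun x => ?_) v.1 v.2
        simp [graphMap] }
    (by ext v a; simp)
    (fun b c => by ext v a; simp [mul_assoc])

theorem graphRep_apply (P : UnboundedRep A D E) (b : A) (v : P.graphClosure) (a : A) :
    (P.graphRep b v).1 a = v.1 (a * b) := rfl

theorem graphClosure_rsmul (P : UnboundedRep A D E) (d : D) :
    ∀ v ∈ P.graphClosure, (fun a => v a <• d) ∈ P.graphClosure := by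
  refine P.graphClosure_induction ?_ fun x => ?_
  · exact (Submodule.isClosed_topologicalClosure _).preimage
      (continuous_pi fun a => (HilbertModule.continuous_rsmul E d).comp (continuous_apply a))
  · have : (fun a => P.graphMap x a <• d)
        = P.graphMap ⟨(x : E) <• d, P.rsmul_mem x x.2 d⟩ := by
      ext a; exact (P.map_rsmul a x d).symm
    rw [this]
    exact P.graphMap_mem _

/-- The closure of a representation: the extension to the completion of the domain in the graph
topology, viewed as a subspace of `E`. -/
noncomputable def closure (P : UnboundedRep A D E) : UnboundedRep A D E where
  dom := P.graphClosure.map (LinearMap.proj (R := ℂ) (φ := fun _ : A => E) 1)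
  dense_dom := P.dense_dom.mono fun x hx =>
    ⟨P.graphMap ⟨x, hx⟩, P.graphMap_mem _, by simp [graphMap]⟩
  rsmul_mem := by
    rintro _ ⟨v, hv, rfl⟩ d
    exact ⟨fun a => v a <• d, P.graphClosure_rsmul d v hv, rfl⟩
  π := (P.graphEquiv.conjAlgEquiv ℂ).toAlgHom.comp P.graphRep
  map_rsmul a x d := by
    obtain ⟨v, rfl⟩ := P.graphEquiv.surjective x
    have : (⟨(P.graphEquiv v : E) <• d, ⟨fun a => v.1 a <• d,
        P.graphClosure_rsmul d v.1 v.2, rfl⟩⟩ :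
          P.graphClosure.map (LinearMap.proj (R := ℂ) (φ := fun _ : A => E) 1))
        = P.graphEquiv ⟨fun a => v.1 a <• d, P.graphClosure_rsmul d v.1 v.2⟩ := rfl
    rw [this]
    simp [graphEquiv_apply, graphRep_apply]
  inner_map_left a x y := by
    obtain ⟨v, rfl⟩ := P.graphEquiv.surjective x
    obtain ⟨w, rfl⟩ := P.graphEquiv.surjective y
    simpa [LinearEquiv.conj_apply, graphEquiv_apply, graphRep_apply] using
      P.graphClosure_inner a v.1 v.2 w.1 w.2

/-- An isometry (see `IsHilbertIsometry`) intertwines two representations of `A` if it maps the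
first domain into the second one and intertwines the operators there. -/
def IsIntertwiner {E' : Type v} [NormedAddCommGroup E'] [NormedSpace ℂ E'] [HilbertModule D E']
    (P : UnboundedRep A D E) (P' : UnboundedRep A D E') (I : E →ₗ[ℂ] E') : Prop :=
  ∀ x : P.dom, ∃ hx : I x ∈ P'.dom, ∀ a : A, I (P.π a x) = P'.π a ⟨I x, hx⟩

end

end UnboundedRep

/-- An isometry of Hilbert `D`-modules: a (not necessarily adjointable) right `D`-module map that
preserves the inner products. -/
def IsHilbertIsometry (D : Type u) {E E' : Type v} [NonUnitalCStarAlgebra D]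
    [NormedAddCommGroup E] [NormedSpace ℂ E] [HilbertModule D E]
    [NormedAddCommGroup E'] [NormedSpace ℂ E'] [HilbertModule D E'] (I : E →ₗ[ℂ] E') : Prop :=
  (∀ (x : E) (d : D), I (x <• d) = I x <• d) ∧ ∀ x y : E, inner D (I x) (I y) = inner D x y

/-- `τ : E × F → T` exhibits the Hilbert `D₂`-module `T` as the interior tensor product
`E ⊗_φ F` of the Hilbert `D₁`-module `E` with the correspondence `(F, φ)` from `D₁` to `D₂`:
elementary tensors have the inner products `⟨x ⊗ y, x' ⊗ y'⟩ = ⟨y, φ(⟨x, x'⟩) y'⟩` and their span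
is dense.  This determines the (complete) Hilbert module `T` up to a unique unitary compatible with
`τ`. -/
structure IsInteriorTensor {D₁ : Type u₁} {D₂ : Type u₂} {E : Type v₁} {F : Type v₂} {T : Type v₃}
    [NonUnitalCStarAlgebra D₁] [NonUnitalCStarAlgebra D₂]
    [NormedAddCommGroup E] [NormedSpace ℂ E] [HilbertModule D₁ E]
    [NormedAddCommGroup F] [NormedSpace ℂ F] [HilbertModule D₂ F]
    [NormedAddCommGroup T] [NormedSpace ℂ T] [HilbertModule D₂ T]
    (φ : CStarRep D₁ D₂ F) (τ : E →ₗ[ℂ] F →ₗ[ℂ] T) : Prop where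
  inner_eq (x x' : E) (y y' : F) :
    inner D₂ (τ x y) (τ x' y') = inner D₂ y (φ.toHom (inner D₁ x x') y')
  dense_span : Dense (Submodule.span ℂ {z : T | ∃ x y, τ x y = z} : Set T)

namespace UnboundedRep

section tensor

open TensorProduct

variable {A : Type w} {D₁ : Type u₁} {D₂ : Type u₂} {E : Type v₁} {F : Type v₂}
    {T : Type v₃}     [Ring A] [StarRing A] [Algebra ℂ A]
    [NonUnitalCStarAlgebra D₁] [NonUnitalCStarAlgebra D₂]
    [NormedAddCommGroup E] [NormedSpace ℂ E] [HilbertModule D₁ E]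
    [NormedAddCommGroup F] [NormedSpace ℂ F] [HilbertModule D₂ F]
    [NormedAddCommGroup T] [NormedSpace ℂ T] [HilbertModule D₂ T]
    {φ : CStarRep D₁ D₂ F} {τ : E →ₗ[ℂ] F →ₗ[ℂ] T}

/-- The canonical map from the algebraic tensor product `dom ⊙ F` to `T`. -/
noncomputable def tensorMap (P : UnboundedRep A D₁ E) (τ : E →ₗ[ℂ] F →ₗ[ℂ] T) :
    P.dom ⊗[ℂ] F →ₗ[ℂ] T :=
  TensorProduct.lift (τ.comp P.dom.subtype)

theorem tensorMap_tmul (P : UnboundedRep A D₁ E) (τ : E →ₗ[ℂ] F →ₗ[ℂ] T) (x : P.dom) (y : F) :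
    P.tensorMap τ (x ⊗ₜ y) = τ x y := rfl

theorem tensor_continuous (h : IsInteriorTensor φ τ) (y : F) : Continuous fun x => τ x y := by
  refine AddMonoidHomClass.continuous_of_bound (τ.flip y) ‖y‖ fun x => ?_
  refine (sq_le_sq₀ (norm_nonneg _) (by positivity)).1 ?_
  change ‖τ x y‖ ^ 2 ≤ _
  rw [HilbertModule.norm_sq_eq (D := D₂), h.inner_eq]
  calc _ ≤ ‖y‖ * ‖φ.toHom (inner D₁ x x) y‖ := HilbertModule.norm_inner_le _ _
    _ ≤ ‖y‖ * (‖inner D₁ x x‖ * ‖y‖) :=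
      mul_le_mul_of_nonneg_left (φ.norm_map_le _ _) (norm_nonneg _)
    _ = _ := by rw [← HilbertModule.norm_sq_eq (D := D₁)]; ring

theorem tensor_rsmul (h : IsInteriorTensor φ τ) (x : E) (y : F) (d : D₂) :
    τ x (y <• d) = τ x y <• d := by
  refine HilbertModule.eq_of_dense (D := D₂) h.dense_span fun z hz => ?_
  induction hz using Submodule.span_induction with
  | mem z hz =>
    obtain ⟨x', y', rfl⟩ := hz
    rw [h.inner_eq, HilbertModule.inner_rsmul_right, h.inner_eq, φ.inner_map_right,
      φ.inner_map_right, HilbertModule.inner_rsmul_right]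
  | zero =>
    have (t : T) : inner D₂ (0 : T) t = 0 := by
      rw [← HilbertModule.star_inner, ← HilbertModule.innerRight_apply, map_zero, star_zero]
    rw [this, this]
  | add a b _ _ ha hb => rw [HilbertModule.inner_add_left, HilbertModule.inner_add_left, ha, hb]
  | smul c a _ ha => rw [HilbertModule.inner_smul_left, HilbertModule.inner_smul_left, ha]

theorem tensorMap_dense (P : UnboundedRep A D₁ E) (h : IsInteriorTensor φ τ) :
    Dense (LinearMap.range (P.tensorMap τ) : Set T) := by
  have key : {z : T | ∃ x y, τ x y = z} ⊆ (LinearMap.range (P.tensorMap τ)).topologicalClosure := by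
    rintro _ ⟨x, y, rfl⟩
    have h1 : Set.MapsTo (fun x => τ x y) P.dom (LinearMap.range (P.tensorMap τ)) := by
      intro x hx
      exact ⟨(⟨x, hx⟩ : P.dom) ⊗ₜ y, rfl⟩
    exact map_mem_closure (f := fun x => τ x y) (tensor_continuous h y) (P.dense_dom x) h1
  have h2 : (LinearMap.range (P.tensorMap τ)).topologicalClosure = ⊤ := by
    rw [eq_top_iff, ← Submodule.dense_iff_topologicalClosure_eq_top.1 h.dense_span]
    exact Submodule.topologicalClosure_minimal _ (Submodule.span_le.2 key)
      (Submodule.isClosed_topologicalClosure _)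
  exact Submodule.dense_iff_topologicalClosure_eq_top.2 h2

theorem tensorMap_inner (P : UnboundedRep A D₁ E) (h : IsInteriorTensor φ τ) (a : A)
    (s t : P.dom ⊗[ℂ] F) :
    inner D₂ (P.tensorMap τ ((P.π a).rTensor F s)) (P.tensorMap τ t)
      = inner D₂ (P.tensorMap τ s) (P.tensorMap τ ((P.π (star a)).rTensor F t)) := by
  have z1 (t : T) : inner D₂ (0 : T) t = 0 := by
    rw [← HilbertModule.star_inner, ← HilbertModule.innerRight_apply, map_zero, star_zero]
  have z2 (t : T) : inner D₂ t (0 : T) = 0 := by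
    rw [← HilbertModule.innerRight_apply, map_zero]
  induction s with
  | zero => simp [z1]
  | add s s' hs hs' =>
    simp only [map_add, HilbertModule.inner_add_left, hs, hs']
  | tmul x y =>
    induction t with
    | zero => simp [z2]
    | add s s' hs hs' =>
      simp only [map_add, HilbertModule.inner_add_right, hs, hs']
    | tmul x' y' =>
      simp only [LinearMap.rTensor_tmul, tensorMap_tmul, h.inner_eq, P.inner_map_left]

theorem tensorMap_ker (P : UnboundedRep A D₁ E) (h : IsInteriorTensor φ τ) (a : A) :
    LinearMap.ker (P.tensorMap τ)
      ≤ (LinearMap.ker (P.tensorMap τ)).comap ((P.π a).rTensor F) := by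
  intro s hs
  rw [Submodule.mem_comap, LinearMap.mem_ker]
  refine HilbertModule.eq_zero_of_dense (D := D₂) (P.tensorMap_dense h) ?_
  rintro _ ⟨t, rfl⟩
  have := P.tensorMap_inner h (star a) t s
  rw [star_star] at this
  rw [← this, LinearMap.mem_ker.1 hs, ← HilbertModule.innerRight_apply, map_zero]

/-- The action `a ↦ π a ⊗ 1` on the image of `dom ⊙ F`, written as a quotient of `dom ⊙ F`. -/
noncomputable def tensorQuot (P : UnboundedRep A D₁ E) (h : IsInteriorTensor φ τ) :
    A →ₐ[ℂ] Module.End ℂ ((P.dom ⊗[ℂ] F) ⧸ LinearMap.ker (P.tensorMap τ)) :=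
  AlgHom.ofLinearMap
    { toFun := fun a => Submodule.mapQ _ _ ((P.π a).rTensor F) (P.tensorMap_ker h a)
      map_add' := fun a b => by
        ext x y
        simp
      map_smul' := fun z a => by
        ext x y
        simp only [map_smul, LinearMap.rTensor_smul, RingHom.id_apply]
        simp }
    (by ext x y; simp)
    (fun a b => by ext x y; simp)

theorem tensorMap_rsmul (P : UnboundedRep A D₁ E) (h : IsInteriorTensor φ τ) (d : D₂)
    (s : P.dom ⊗[ℂ] F) : ∃ t : P.dom ⊗[ℂ] F, P.tensorMap τ t = P.tensorMap τ s <• d ∧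
      ∀ a, P.tensorMap τ ((P.π a).rTensor F t) = P.tensorMap τ ((P.π a).rTensor F s) <• d := by
  induction s with
  | zero =>
    have h0 : (0 : T) <• d = 0 := by
      simpa using HilbertModule.smul_rsmul (D := D₂) 0 (0 : T) d
    exact ⟨0, by simp [h0], fun a => by simp [h0]⟩
  | add s s' hs hs' =>
    obtain ⟨t, h1, h2⟩ := hs
    obtain ⟨t', h1', h2'⟩ := hs'
    exact ⟨t + t', by rw [map_add, map_add, HilbertModule.add_rsmul, h1, h1'], fun a => by
      rw [map_add, map_add, map_add, map_add, HilbertModule.add_rsmul, h2, h2']⟩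
  | tmul x y =>
    exact ⟨x ⊗ₜ (y <• d), by rw [tensorMap_tmul, tensorMap_tmul, tensor_rsmul h], fun a => by
      rw [LinearMap.rTensor_tmul, LinearMap.rTensor_tmul, tensorMap_tmul, tensorMap_tmul,
        tensor_rsmul h]⟩

theorem tensorConj_apply (P : UnboundedRep A D₁ E) (h : IsInteriorTensor φ τ) (a : A)
    (x : LinearMap.range (P.tensorMap τ)) (s : P.dom ⊗[ℂ] F) (hs : P.tensorMap τ s = x) :
    ((((P.tensorMap τ).quotKerEquivRange.conjAlgEquiv ℂ).toAlgHom.comp (P.tensorQuot h)) a x : T)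
      = P.tensorMap τ ((P.π a).rTensor F s) := by
  have h1 : x = (P.tensorMap τ).quotKerEquivRange (Submodule.Quotient.mk s) := by
    apply Subtype.ext
    rw [LinearMap.quotKerEquivRange_apply_mk, hs]
  rw [h1]
  simp [tensorQuot]

/-- The representation `a ↦ π a ⊗ 1` on the image of `dom ⊙ F` in `T`, so that
`(π a ⊗ 1) (x ⊗ y) = π a x ⊗ y`. -/
noncomputable def preTensor (P : UnboundedRep A D₁ E) (h : IsInteriorTensor φ τ) :
    UnboundedRep A D₂ T where
  dom := LinearMap.range (P.tensorMap τ)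
  dense_dom := P.tensorMap_dense h
  rsmul_mem := by
    rintro _ ⟨s, rfl⟩ d
    obtain ⟨t, ht, -⟩ := P.tensorMap_rsmul h d s
    exact ⟨t, ht⟩
  π := ((P.tensorMap τ).quotKerEquivRange.conjAlgEquiv ℂ).toAlgHom.comp (P.tensorQuot h)
  map_rsmul a x d := by
    obtain ⟨s, hs⟩ := LinearMap.mem_range.1 x.2
    obtain ⟨t, ht, ht'⟩ := P.tensorMap_rsmul h d s
    rw [P.tensorConj_apply h a x s hs, P.tensorConj_apply h a _ t (by rw [ht, hs]), ht' a]
  inner_map_left a x y := by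
    obtain ⟨s, hs⟩ := LinearMap.mem_range.1 x.2
    obtain ⟨t, ht⟩ := LinearMap.mem_range.1 y.2
    rw [P.tensorConj_apply h a x s hs, P.tensorConj_apply h _ y t ht, ← hs, ← ht]
    exact P.tensorMap_inner h a s t

theorem preTensor_apply (P : UnboundedRep A D₁ E) (h : IsInteriorTensor φ τ) (a : A)
    (x : P.dom) (y : F) (hxy : τ x y ∈ (P.preTensor h).dom) :
    ((P.preTensor h).π a ⟨τ x y, hxy⟩ : T) = τ (P.π a x) y :=
  P.tensorConj_apply h a _ (x ⊗ₜ y) rfl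

/-- The interior tensor product `(dom ⊗ F, π ⊗ 1)` of a representation with a correspondence: the
closure of the representation on the image of `dom ⊙ F`. -/
noncomputable def tensor (P : UnboundedRep A D₁ E) (h : IsInteriorTensor φ τ) :
    UnboundedRep A D₂ T :=
  (P.preTensor h).closure

end tensor

end UnboundedRep

namespace CStarRep

variable {B : Type w} {D : Type u} {E : Type v} [NonUnitalCStarAlgebra B]
    [NonUnitalCStarAlgebra D] [NormedAddCommGroup E] [NormedSpace ℂ E] [HilbertModule D E]

/-- The action map `(b, x) ↦ ρ b x`. -/
def actionMap (ρ : CStarRep B D E) : B →ₗ[ℂ] E →ₗ[ℂ] E where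
  toFun b := (ρ.toHom b : E →L[ℂ] E)
  map_add' a b := by ext x; simp
  map_smul' z b := by ext x; simp

/-- The canonical unitary `B ⊗_ρ E ≅ E`, `b ⊗ x ↦ ρ b x`: the Hilbert module `E` is itself the
interior tensor product of `B` with the correspondence `(E, ρ)`. -/
theorem isInteriorTensor (ρ : CStarRep B D E) : IsInteriorTensor ρ ρ.actionMap where
  inner_eq b b' x x' := by
    change inner D (ρ.toHom b x) (ρ.toHom b' x') = inner D x (ρ.toHom (star b * b') x')
    rw [ρ.inner_map_left, map_mul]
    rfl
  dense_span := ρ.nondegenerate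

end CStarRep

/-- The representation `μ ⊗_ρ 1_E` of `A` on `E ≅ B ⊗_ρ E`, for a representation `μ` of `A` on the
C*-algebra `B`, viewed as a Hilbert module over itself, and a representation `ρ` of `B` on `E`. -/
noncomputable def UnboundedRep.induced {A : Type u₁} {B : Type w} {D : Type u} {E : Type v}
    [Ring A] [StarRing A] [Algebra ℂ A] [NonUnitalCStarAlgebra B]
    [NonUnitalCStarAlgebra D] [NormedAddCommGroup E] [NormedSpace ℂ E] [HilbertModule D E]
    (μ : UnboundedRep A B B) (ρ : CStarRep B D E) : UnboundedRep A D E :=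
  μ.tensor ρ.isInteriorTensor

namespace HilbertModule

variable {E : Type v} [NormedAddCommGroup E] [NormedSpace ℂ E]

/-- The graph of the adjoint of a partially defined operator `t` on a Hilbert module: all pairs
`(y, z)` with `⟨t x, y⟩ = ⟨x, z⟩` for all `x` in the domain of `t`. -/
def adjointGraph (D : Type u) [NonUnitalCStarAlgebra D] [HilbertModule D E] (t : E →ₗ.[ℂ] E) :
    Submodule ℂ (E × E) where
  carrier := {p | ∀ x : t.domain, inner D (t x) p.1 = inner D (x : E) p.2}
  zero_mem' x := by
    change inner D (t x) (0 : E) = inner D (x : E) (0 : E)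
    rw [← innerRight_apply, ← innerRight_apply, map_zero, map_zero]
  add_mem' {p q} hp hq x := by
    change inner D (t x) (p.1 + q.1) = inner D (x : E) (p.2 + q.2)
    rw [inner_add_right, inner_add_right, hp x, hq x]
  smul_mem' c p hp x := by
    change inner D (t x) (c • p.1) = inner D (x : E) (c • p.2)
    rw [inner_smul_right, inner_smul_right, hp x]

/-- The adjoint of a densely defined operator on a Hilbert module.  (If the domain of `t` is not
dense, then the value is irrelevant.) -/
noncomputable def adjoint (D : Type u) [NonUnitalCStarAlgebra D] [HilbertModule D E]
    (t : E →ₗ.[ℂ] E) : E →ₗ.[ℂ] E :=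
  (adjointGraph D t).toLinearPMap

/-- The composite `g ∘ f` of partially defined operators, with domain
`{x ∈ dom f | f x ∈ dom g}`. -/
def compOp (g f : E →ₗ.[ℂ] E) : E →ₗ.[ℂ] E :=
  g.comp (f.domRestrict ((g.domain.comap f.toFun).map f.domain.subtype)) (by
    rintro ⟨x, ⟨y, hy, rfl⟩, hx⟩
    exact hy)

/-- The powers of a partially defined operator, with their natural domains. -/
def powOp (t : E →ₗ.[ℂ] E) : ℕ → (E →ₗ.[ℂ] E)
  | 0 => LinearMap.id.toPMap ⊤
  | n + 1 => compOp t (powOp t n)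

/-- A regular operator: densely defined and closed, with densely defined adjoint, and such that
`1 + t* t` has dense range. -/
def IsRegular (D : Type u) [NonUnitalCStarAlgebra D] [HilbertModule D E] (t : E →ₗ.[ℂ] E) : Prop :=
  Dense (t.domain : Set E) ∧ t.IsClosed ∧ Dense ((adjoint D t).domain : Set E) ∧
    Dense {z : E | ∃ x : (compOp (adjoint D t) t).domain, (x : E) + compOp (adjoint D t) t x = z}

/-- A self-adjoint operator: densely defined and equal to its adjoint. -/
def IsSelfAdjointOp (D : Type u) [NonUnitalCStarAlgebra D] [HilbertModule D E]
    (t : E →ₗ.[ℂ] E) : Prop :=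
  Dense (t.domain : Set E) ∧ adjoint D t = t

theorem mem_compOp_domain (g f : E →ₗ.[ℂ] E) (x : E) :
    x ∈ (compOp g f).domain ↔ ∃ h : x ∈ f.domain, f ⟨x, h⟩ ∈ g.domain := by
  constructor
  · rintro ⟨⟨y, hy, rfl⟩, hx⟩
    exact ⟨hx, hy⟩
  · rintro ⟨h, hx⟩
    exact ⟨⟨⟨x, h⟩, hx, rfl⟩, h⟩

theorem compOp_apply (g f : E →ₗ.[ℂ] E) (x : E) (h : x ∈ f.domain) (h' : f ⟨x, h⟩ ∈ g.domain)
    (hx : x ∈ (compOp g f).domain) : compOp g f ⟨x, hx⟩ = g ⟨f ⟨x, h⟩, h'⟩ := rfl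

theorem mem_adjoint_graph (D : Type u) [NonUnitalCStarAlgebra D] [HilbertModule D E]
    (t : E →ₗ.[ℂ] E) (ht : Dense (t.domain : Set E)) (y z : E) :
    (y, z) ∈ (adjoint D t).graph ↔ ∀ x : t.domain, inner D (t x) y = inner D (x : E) z := by
  rw [adjoint, Submodule.toLinearPMap_graph_eq]
  · rfl
  · rintro ⟨a, b⟩ hab ha
    change a = 0 at ha
    subst ha
    refine eq_zero_of_dense (D := D) ht fun x hx => ?_
    have := hab ⟨x, hx⟩
    rw [← innerRight_apply, map_zero] at this
    exact this.symm

end HilbertModule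


/-- The involution on `ℂ[X]` with `X* = X`: conjugation of the coefficients. -/
noncomputable instance Polynomial.instStarRingComplex : StarRing ℂ[X] where
  star p := p.map (starRingEnd ℂ)
  star_involutive p := by
    ext n
    simp
  star_mul p q := by
    change (p * q).map (starRingEnd ℂ) = q.map (starRingEnd ℂ) * p.map (starRingEnd ℂ)
    rw [Polynomial.map_mul, mul_comm]
  star_add p q := Polynomial.map_add _

theorem Polynomial.star_def_complex (p : ℂ[X]) : star p = p.map (starRingEnd ℂ) := rfl

instance Polynomial.instStarModuleComplex : StarModule ℂ ℂ[X] where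
  star_smul z p := by
    simp [Polynomial.star_def_complex, Polynomial.map_smul]

/-- The domain of the canonical representation of `ℂ[X]` on `C₀(ℝ)`: all `f` such that
`t ↦ t ^ n * f t` belongs to `C₀(ℝ)` for all `n`. -/
def muDom : Submodule ℂ C₀(ℝ, ℂ) where
  carrier := {f | ∀ n : ℕ, ∃ g : C₀(ℝ, ℂ), ∀ t : ℝ, g t = (t : ℂ) ^ n * f t}
  zero_mem' n := ⟨0, fun t => by simp⟩
  add_mem' {f f'} hf hf' n := by
    obtain ⟨g, hg⟩ := hf n
    obtain ⟨g', hg'⟩ := hf' n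
    exact ⟨g + g', fun t => by simp [hg, hg', mul_add]⟩
  smul_mem' c f hf n := by
    obtain ⟨g, hg⟩ := hf n
    exact ⟨c • g, fun t => by simp [hg, mul_left_comm]⟩

theorem muDom_exists {f : C₀(ℝ, ℂ)} (hf : f ∈ muDom) (p : ℂ[X]) :
    ∃ g : C₀(ℝ, ℂ), ∀ t : ℝ, g t = p.eval (t : ℂ) * f t := by
  induction p using Polynomial.induction_on' with
  | add p q hp hq =>
    obtain ⟨g, hg⟩ := hp
    obtain ⟨g', hg'⟩ := hq
    exact ⟨g + g', fun t => by simp [hg, hg', add_mul]⟩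
  | monomial n c =>
    obtain ⟨g, hg⟩ := hf n
    exact ⟨c • g, fun t => by simp [hg, mul_assoc]⟩

/-- Multiplication by a polynomial function, on `muDom`. -/
noncomputable def muMul (p : ℂ[X]) (f : muDom) : muDom where
  val :=
    { toFun := fun t => p.eval (t : ℂ) * f.1 t
      continuous_toFun := by
        obtain ⟨g, hg⟩ := muDom_exists f.2 p
        simp only [← hg]
        exact g.continuous_toFun
      zero_at_infty' := by
        obtain ⟨g, hg⟩ := muDom_exists f.2 p
        simp only [← hg]
        exact g.zero_at_infty' }
  property n := by
    obtain ⟨g, hg⟩ := muDom_exists f.2 (Polynomial.X ^ n * p)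
    exact ⟨g, fun t => by simp [hg, mul_assoc]⟩

theorem muMul_apply (p : ℂ[X]) (f : muDom) (t : ℝ) :
    (muMul p f).1 t = p.eval (t : ℂ) * f.1 t := rfl

theorem muDom_dense : Dense (muDom : Set C₀(ℝ, ℂ)) := by
  intro f
  rw [Metric.mem_closure_iff]
  intro ε hε
  obtain ⟨K, hK, hKf⟩ := mem_cocompact.1
    (f.zero_at_infty' (Metric.ball_mem_nhds (0 : ℂ) (half_pos hε)))
  obtain ⟨R, hR⟩ := hK.isBounded.subset_closedBall (0 : ℝ)
  let χ : ℝ → ℝ := fun t => max 0 (min 1 (R + 1 - |t|))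
  have hχ : Continuous χ := by fun_prop
  have hχ0 (t : ℝ) : 0 ≤ χ t := le_max_left _ _
  have hχ1 (t : ℝ) : χ t ≤ 1 := max_le zero_le_one (min_le_left _ _)
  have hout : ∀ᶠ t in cocompact ℝ, χ t = 0 := by
    have : ∀ᶠ t in cocompact ℝ, t ∈ (Metric.closedBall (0 : ℝ) (R + 1))ᶜ :=
      (isCompact_closedBall _ _).compl_mem_cocompact
    filter_upwards [this] with t ht
    rw [Set.mem_compl_iff, mem_closedBall_zero_iff, Real.norm_eq_abs, not_le] at ht
    exact max_eq_left ((min_le_right _ _).trans (by linarith))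
  have hzero (n : ℕ) : Tendsto (fun t : ℝ => (t : ℂ) ^ n * ((χ t : ℂ) * f t))
      (cocompact ℝ) (𝓝 0) := by
    refine tendsto_const_nhds.congr' ?_
    filter_upwards [hout] with t ht
    simp [ht]
  have hfc : Continuous fun t => f t := f.continuous_toFun
  have hcont (n : ℕ) : Continuous fun t : ℝ => (t : ℂ) ^ n * ((χ t : ℂ) * f t) := by fun_prop
  let g : C₀(ℝ, ℂ) :=
    { toFun := fun t => (χ t : ℂ) * f t
      continuous_toFun := by simpa using hcont 0
      zero_at_infty' := by simpa using hzero 0 }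
  refine ⟨g, fun n => ⟨⟨⟨_, hcont n⟩, hzero n⟩, fun t => rfl⟩, ?_⟩
  refine lt_of_le_of_lt ?_ (half_lt_self hε)
  rw [← ZeroAtInftyContinuousMap.dist_toBCF_eq_dist,
    BoundedContinuousFunction.dist_le (half_pos hε).le]
  intro t
  change dist (f t) ((χ t : ℂ) * f t) ≤ ε / 2
  by_cases ht : t ∈ K
  · have h1 : |t| ≤ R := by simpa using hR ht
    have h2 : χ t = 1 := by
      have : min 1 (R + 1 - |t|) = 1 := min_eq_left (by linarith)
      simp only [χ, this]
      norm_num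
    simp [h2, (half_pos hε).le]
  · have h1 : ‖f t‖ < ε / 2 := by simpa using hKf ht
    have h2 : f t - (χ t : ℂ) * f t = ((1 - χ t : ℝ) : ℂ) * f t := by push_cast; ring
    rw [dist_eq_norm, h2, norm_mul, Complex.norm_real,
      Real.norm_of_nonneg (by linarith [hχ1 t])]
    nlinarith [hχ0 t, hχ1 t, norm_nonneg (f t)]

/-- The canonical representation `μ` of `ℂ[X]` on `C₀(ℝ)`: the polynomial `p` acts on `muDom` by
pointwise multiplication, in particular `X ^ n` acts by multiplication with `t ↦ t ^ n`. -/
noncomputable def muRep : UnboundedRep ℂ[X] C₀(ℝ, ℂ) C₀(ℝ, ℂ) where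
  dom := muDom
  dense_dom := muDom_dense
  rsmul_mem f hf d n := by
    obtain ⟨g, hg⟩ := hf n
    refine ⟨g * d, fun t => ?_⟩
    change g t * d t = (t : ℂ) ^ n * (f t * d t)
    rw [hg, mul_assoc]
  π := AlgHom.ofLinearMap
    { toFun := fun p =>
        { toFun := muMul p
          map_add' := fun f g => by ext t; simp [muMul_apply, mul_add]
          map_smul' := fun z f => by ext t; simp [muMul_apply, mul_left_comm] }
      map_add' := fun p q => by ext f t; simp [muMul_apply, add_mul]
      map_smul' := fun z p => by ext f t; simp [muMul_apply, mul_assoc] }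
    (by ext f t; simp [muMul_apply])
    (fun p q => by ext f t; simp [muMul_apply, mul_assoc])
  map_rsmul p f d := by
    ext t
    change p.eval (t : ℂ) * (f.1 t * d t) = p.eval (t : ℂ) * f.1 t * d t
    rw [mul_assoc]
  inner_map_left p f g := by
    ext t
    change star (p.eval (t : ℂ) * f.1 t) * g.1 t
      = star (f.1 t) * ((p.map (starRingEnd ℂ)).eval (t : ℂ) * g.1 t)
    have : (p.map (starRingEnd ℂ)).eval (t : ℂ) = star (p.eval (t : ℂ)) := by
      conv_lhs => rw [← Complex.conj_ofReal t]
      exact Polynomial.eval_map_apply (starRingEnd ℂ) (t : ℂ)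
    rw [this, star_mul]
    ring

/-- A C*-hull.  Here `Integrable` singles out the integrable representations among the closed
representations of `A` on Hilbert modules over C*-algebras (in fixed universes), and `Φ` is a family
of maps from representations of the C*-algebra `B` to representations of `A` on the same Hilbert
module.  The pair `(B, Φ)` is a C*-hull if each `Φ` is a bijection onto the integrable
representations, and `Φ` is compatible with isometric intertwiners and with interior tensor
products. -/
structure IsCStarHull (A : Type w) [Ring A] [StarRing A] [Algebra ℂ A] [StarModule ℂ A]
    (B : Type u₁) [NonUnitalCStarAlgebra B]
    (Integrable : ∀ (D : Type u) (E : Type v) [NonUnitalCStarAlgebra D] [NormedAddCommGroup E]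
      [NormedSpace ℂ E] [CompleteSpace E] [HilbertModule D E], UnboundedRep A D E → Prop)
    (Φ : ∀ (D : Type u) (E : Type v) [NonUnitalCStarAlgebra D] [NormedAddCommGroup E]
      [NormedSpace ℂ E] [CompleteSpace E] [HilbertModule D E],
      CStarRep B D E → UnboundedRep A D E) : Prop where
  bijective (D : Type u) (E : Type v) [NonUnitalCStarAlgebra D] [NormedAddCommGroup E]
    [NormedSpace ℂ E] [CompleteSpace E] [HilbertModule D E] :
    Set.BijOn (Φ D E) Set.univ {P | P.IsClosed ∧ Integrable D E P}
  /-- An isometry intertwines `ρ₁` and `ρ₂` if and only if it intertwines `Φ ρ₁` and `Φ ρ₂`. -/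
  isometry_intertwines_iff (D : Type u) (E₁ E₂ : Type v) [NonUnitalCStarAlgebra D]
    [NormedAddCommGroup E₁] [NormedSpace ℂ E₁] [CompleteSpace E₁] [HilbertModule D E₁]
    [NormedAddCommGroup E₂] [NormedSpace ℂ E₂] [CompleteSpace E₂] [HilbertModule D E₂]
    (ρ₁ : CStarRep B D E₁) (ρ₂ : CStarRep B D E₂) (I : E₁ →ₗ[ℂ] E₂)
    (hI : IsHilbertIsometry D I) :
    (∀ b x, I (ρ₁.toHom b x) = ρ₂.toHom b (I x)) ↔ (Φ D E₁ ρ₁).IsIntertwiner (Φ D E₂ ρ₂) I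
  /-- For a correspondence `(F, φ)` from `D₁` to `D₂` and a representation `ρ` of `B` on `E`, the
  representation `ρ' = ρ ⊗ 1` of `B` on `T = E ⊗_φ F` exists and `Φ (ρ ⊗ 1) = Φ ρ ⊗ 1`. -/
  interior_tensor (D₁ D₂ : Type u) (E F T : Type v)
    [NonUnitalCStarAlgebra D₁] [NonUnitalCStarAlgebra D₂]
    [NormedAddCommGroup E] [NormedSpace ℂ E] [CompleteSpace E] [HilbertModule D₁ E]
    [NormedAddCommGroup F] [NormedSpace ℂ F] [CompleteSpace F] [HilbertModule D₂ F]
    [NormedAddCommGroup T] [NormedSpace ℂ T] [CompleteSpace T] [HilbertModule D₂ T]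
    (φ : CStarRep D₁ D₂ F) (τ : E →ₗ[ℂ] F →ₗ[ℂ] T) (h : IsInteriorTensor φ τ)
    (ρ : CStarRep B D₁ E) :
    ∃ ρ' : CStarRep B D₂ T, (∀ b x y, ρ'.toHom b (τ x y) = τ (ρ.toHom b x) y) ∧
      Φ D₂ T ρ' = (Φ D₁ E ρ).tensor h

/-- Integrability for representations of `ℂ[X]`: the closures of all symmetric elements are regular
and self-adjoint. -/
def UnboundedRep.IsIntegrable {D : Type u} {E : Type v} [NonUnitalCStarAlgebra D]
    [NormedAddCommGroup E] [NormedSpace ℂ E] [HilbertModule D E]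
    (P : UnboundedRep ℂ[X] D E) : Prop :=
  ∀ a : ℂ[X], IsSelfAdjoint a →
    HilbertModule.IsRegular D (P.op a).closure ∧ HilbertModule.IsSelfAdjointOp D (P.op a).closure

/-! The argument is carried out with graphs. A representation of `A` is recorded by the subspace of
all families `(π a x)ₐ` in `∏ₐ E`. This subspace determines the representation (`ext_graph`), and
closures and interior tensor products are closures of such subspaces.

For a representation `ρ` of `C₀(ℝ)`, multiplication by `p` becomes the closed relation `multGraph
p`, defined by testing against functions in `muDom`. The cutoff functions lie in `muDom`, and `ρ`
maps them to operators converging strongly to the identity. Hence `Φ(ρ)` acts by the operators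
`multGraph p` on their common domain, each `multGraph p` is the closure of the operator of `p`, and
its adjoint is `multGraph (star p)`. Cutoffs divided by `1 + |p|²` stay in `muDom`, which gives
regularity. So an induced representation is integrable in every sense of the list.

Conversely, let `t` be regular and self-adjoint. The factorisation `1 + t² = (t + i)(t - i)` shows
that `t ± i` are bijective, with bounded inverses adjoint to each other. By the resolvent identity
`(t + i)⁻¹` is normal and its quasispectrum lies in `{z | z = 0 or Im z⁻¹ = 1}`, the circle traced
by `(s + i)⁻¹` for real `s`, together with `0`. Functional calculus in the C*-algebra of adjointable
operators then yields `ρ` for which `t` is `multGraph X` (`exists_multGraph_eq`).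

For `t` the closure of `π x`, it follows that `π` is a restriction of `Φ(ρ)`, so only the domains
remain to be compared. Condition 5 does this directly. Conditions 3 and 4 identify the closure of
each `π (x ^ n)` with `multGraph (X ^ n)`; under 3 this holds because self-adjoint operators have no
proper self-adjoint extensions. The identity `t^k = t^k/(1 + t^(2N)) + t^(k+N)/(1 + t^(2N)) * t^N`
for `k < N` bounds lower powers by the `N`-th one. Hence approximation in the graph norms of single
powers can be turned into approximation in the whole graph topology (`eq_induced_of_closure`).

For the hull property, `(t + i)⁻¹` generates `C₀(ℝ)`, so an isometry that respects the operator of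
`x` respects its resolvents and hence `ρ`. Injectivity of `Φ` is the case of the identity isometry.
Compatibility with tensor products is a comparison of spanning vectors in `∏ₐ T`. -/

/-! ### Adjoints and composites of unbounded operators. -/

namespace HilbertModule

variable {D : Type u} {E : Type v} [NonUnitalCStarAlgebra D]
  [NormedAddCommGroup E] [NormedSpace ℂ E] [HilbertModule D E]

theorem inner_zero_right (x : E) : inner D x (0 : E) = 0 := by
  rw [← innerRight_apply, map_zero]

theorem inner_zero_left (x : E) : inner D (0 : E) x = 0 := by
  rw [← star_inner, inner_zero_right, star_zero]

theorem inner_sub_left (x y z : E) : inner D (x - y) z = inner D x z - inner D y z := by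
  rw [← star_inner z (x - y), inner_sub_right, star_sub, star_inner, star_inner]

theorem isClosed_adjointGraph (t : E →ₗ.[ℂ] E) :
    IsClosed (adjointGraph D t : Set (E × E)) := by
  have : (adjointGraph D t : Set (E × E))
      = ⋂ x : t.domain, {p : E × E | inner D (t x) p.1 = inner D (x : E) p.2} := by
    ext p
    simp [adjointGraph]
  rw [this]
  exact isClosed_iInter fun x => isClosed_eq
    ((continuous_inner_right _).comp continuous_fst)
    ((continuous_inner_right _).comp continuous_snd)

theorem isClosed_adjoint {t : E →ₗ.[ℂ] E} (ht : Dense (t.domain : Set E)) :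
    (adjoint D t).IsClosed := by
  have : (adjoint D t).graph = adjointGraph D t := by
    ext ⟨y, z⟩
    exact mem_adjoint_graph D t ht y z
  rw [LinearPMap.IsClosed, this]
  exact isClosed_adjointGraph t

/-- Composing operators as relations avoids carrying proofs of domain membership. -/
theorem mem_compOp_graph (g f : E →ₗ.[ℂ] E) (x z : E) :
    (x, z) ∈ (compOp g f).graph ↔ ∃ y, (x, y) ∈ f.graph ∧ (y, z) ∈ g.graph := by
  simp only [LinearPMap.mem_graph_iff']
  constructor
  · rintro ⟨⟨x, hx⟩, hxz⟩
    obtain ⟨rfl, rfl⟩ := Prod.ext_iff.1 hxz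
    obtain ⟨h, h'⟩ := (mem_compOp_domain g f x).1 hx
    exact ⟨f ⟨x, h⟩, ⟨⟨x, h⟩, rfl⟩, ⟨_, h'⟩, rfl⟩
  · rintro ⟨y, ⟨⟨x, h⟩, hxy⟩, ⟨⟨y, h'⟩, hyz⟩⟩
    obtain ⟨rfl, rfl⟩ := Prod.ext_iff.1 hxy
    obtain ⟨hy, rfl⟩ := Prod.ext_iff.1 hyz
    change y = f ⟨x, h⟩ at hy
    subst hy
    exact ⟨⟨x, (mem_compOp_domain g f x).2 ⟨h, h'⟩⟩, rfl⟩

end HilbertModule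

/-! ### Representations as subspaces of a product. -/

namespace UnboundedRep

section

variable {A : Type w} {D : Type u} {E : Type v} [Ring A] [StarRing A] [Algebra ℂ A]
    [NonUnitalCStarAlgebra D] [NormedAddCommGroup E] [NormedSpace ℂ E] [HilbertModule D E]

theorem graphMap_one (P : UnboundedRep A D E) (x : P.dom) : P.graphMap x 1 = x := by
  simp [graphMap]

theorem mem_dom_iff (P : UnboundedRep A D E) (x : E) :
    x ∈ P.dom ↔ ∃ v ∈ LinearMap.range P.graphMap, v 1 = x := by
  constructor
  · exact fun hx => ⟨_, ⟨⟨x, hx⟩, rfl⟩, P.graphMap_one _⟩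
  · rintro ⟨_, ⟨y, rfl⟩, rfl⟩
    rw [graphMap_one]
    exact y.2

/-- A representation is determined by its graph in `∏ₐ E`. -/
theorem ext_graph {P Q : UnboundedRep A D E}
    (h : LinearMap.range P.graphMap = LinearMap.range Q.graphMap) : P = Q := by
  have hdom : P.dom = Q.dom := by
    ext x
    rw [mem_dom_iff, mem_dom_iff, h]
  have hπ (a : A) (x : E) (hP : x ∈ P.dom) (hQ : x ∈ Q.dom) :
      (P.π a ⟨x, hP⟩ : E) = Q.π a ⟨x, hQ⟩ := by
    have : P.graphMap ⟨x, hP⟩ ∈ LinearMap.range Q.graphMap := h ▸ ⟨_, rfl⟩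
    obtain ⟨y, hy⟩ := this
    have h1 : y = ⟨x, hQ⟩ := by
      apply Subtype.ext
      rw [← Q.graphMap_one y, hy, graphMap_one]
    subst h1
    exact (congrFun hy a).symm
  obtain ⟨dom, _, _, π, _, _⟩ := P
  obtain ⟨dom', _, _, π', _, _⟩ := Q
  dsimp only at hdom
  subst hdom
  have : π = π' := by
    ext a x
    exact hπ a x x.2 x.2
  subst this
  rfl

/-- This turns every later question about the closure of a representation into one about a closed
subspace of `∏ₐ E`. -/
theorem range_graphMap_closure (P : UnboundedRep A D E) :
    LinearMap.range P.closure.graphMap = P.graphClosure := by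
  have key (v : P.graphClosure) : P.closure.graphMap (P.graphEquiv v) = v.1 := by
    ext a
    change (((P.graphEquiv.conjAlgEquiv ℂ) (P.graphRep a) (P.graphEquiv v)) : E) = _
    simp [graphEquiv_apply, graphRep_apply]
  ext w
  constructor
  · rintro ⟨x, rfl⟩
    obtain ⟨v, rfl⟩ := P.graphEquiv.surjective x
    rw [key]
    exact v.2
  · exact fun hw => ⟨_, key ⟨w, hw⟩⟩

theorem isClosed_iff_isClosed_range [CompleteSpace E] (P : UnboundedRep A D E) :
    P.IsClosed ↔ _root_.IsClosed (LinearMap.range P.graphMap : Set (A → E)) :=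
  ⟨IsComplete.isClosed, _root_.IsClosed.isComplete⟩

theorem dense_op_domain (P : UnboundedRep A D E) (a : A) :
    Dense ((P.op a).domain : Set E) := P.dense_dom

theorem mem_op_graph (P : UnboundedRep A D E) (a : A) (x : P.dom) :
    ((x : E), (P.π a x : E)) ∈ (P.op a).graph :=
  (P.op a).mem_graph x

theorem mem_op_graph_iff (P : UnboundedRep A D E) (a : A) (z : E × E) :
    z ∈ (P.op a).graph ↔ ∃ x : P.dom, ((x : E), (P.π a x : E)) = z :=
  LinearPMap.mem_graph_iff' _

theorem op_le_adjoint (P : UnboundedRep A D E) (a : A) :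
    P.op a ≤ HilbertModule.adjoint D (P.op (star a)) := by
  refine LinearPMap.le_of_le_graph ?_
  rintro ⟨y, z⟩ hyz
  obtain ⟨x, hx⟩ := (P.mem_op_graph_iff a _).1 hyz
  obtain ⟨rfl, rfl⟩ := Prod.ext_iff.1 hx
  rw [HilbertModule.mem_adjoint_graph _ _ (P.dense_op_domain _)]
  intro w
  have := P.inner_map_left (star a) w x
  rwa [star_star] at this

/-- The operator is contained in the adjoint of the operator of `star a`, and adjoints are closed.
-/
theorem isClosable_op (P : UnboundedRep A D E) (a : A) : (P.op a).IsClosable :=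
  (HilbertModule.isClosed_adjoint (P.dense_op_domain _)).isClosable.leIsClosable (P.op_le_adjoint a)

theorem graph_closure_op (P : UnboundedRep A D E) (a : A) :
    (P.op a).closure.graph = (P.op a).graph.topologicalClosure :=
  (P.isClosable_op a).graph_closure_eq_closure_graph.symm

end

section tensor

open TensorProduct

variable {A : Type w} {D₁ : Type u₁} {D₂ : Type u₂} {E : Type v₁} {F : Type v₂}
    {T : Type v₃} [Ring A] [StarRing A] [Algebra ℂ A]
    [NonUnitalCStarAlgebra D₁] [NonUnitalCStarAlgebra D₂]
    [NormedAddCommGroup E] [NormedSpace ℂ E] [HilbertModule D₁ E]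
    [NormedAddCommGroup F] [NormedSpace ℂ F] [HilbertModule D₂ F]
    [NormedAddCommGroup T] [NormedSpace ℂ T] [HilbertModule D₂ T]
    {φ : CStarRep D₁ D₂ F} {τ : E →ₗ[ℂ] F →ₗ[ℂ] T}

/-- The graph of the interior tensor product is the smallest closed subspace that contains the
vectors `(π a x ⊗ y)ₐ`. -/
theorem range_graphMap_tensor (P : UnboundedRep A D₁ E) (h : IsInteriorTensor φ τ) :
    LinearMap.range (P.tensor h).graphMap
      = (Submodule.span ℂ {v : A → T | ∃ (x : P.dom) (y : F),
          v = fun a => τ (P.π a x) y}).topologicalClosure := by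
  rw [tensor, range_graphMap_closure, graphClosure]
  congr 1
  apply le_antisymm
  · rintro _ ⟨⟨_, s, rfl⟩, rfl⟩
    have key : (P.preTensor h).graphMap ⟨P.tensorMap τ s, s, rfl⟩
        = fun a => P.tensorMap τ ((P.π a).rTensor F s) := by
      ext a
      exact P.tensorConj_apply h a _ s rfl
    rw [key]
    clear key
    induction s with
    | zero =>
      simp only [map_zero]
      exact Submodule.zero_mem _
    | add s t hs ht =>
      simp only [map_add]
      exact Submodule.add_mem _ hs ht
    | tmul x y => exact Submodule.subset_span ⟨x, y, rfl⟩
  · rw [Submodule.span_le]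
    rintro _ ⟨x, y, rfl⟩
    refine ⟨⟨τ x y, x ⊗ₜ y, rfl⟩, ?_⟩
    ext a
    exact P.preTensor_apply h a x y _

end tensor

end UnboundedRep

/-! ### Resolvents, cutoffs and transport to the circle in `C₀(ℝ)`. -/

namespace ZeroAtInftyContinuousMap

theorem norm_le_of_forall {f : C₀(ℝ, ℂ)} {C : ℝ} (hC : 0 ≤ C) (h : ∀ t, ‖f t‖ ≤ C) : ‖f‖ ≤ C := by
  rw [← norm_toBCF_eq_norm, BoundedContinuousFunction.norm_le hC]
  exact h

theorem norm_apply_le (f : C₀(ℝ, ℂ)) (t : ℝ) : ‖f t‖ ≤ ‖f‖ := by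
  rw [← norm_toBCF_eq_norm]
  exact f.toBCF.norm_coe_le_norm t

/-- The product of a function in `C₀(ℝ)` with a bounded continuous function. -/
noncomputable def boundedMul (h : ℝ → ℂ) (hh : Continuous h) (C : ℝ) (hC : ∀ t, ‖h t‖ ≤ C) (f : C₀(ℝ, ℂ)) :
    C₀(ℝ, ℂ) where
  toFun t := h t * f t
  continuous_toFun := hh.mul f.continuous_toFun
  zero_at_infty' := by
    exact isBoundedUnder_le_mul_tendsto_zero (isBoundedUnder_of ⟨C, hC⟩) f.zero_at_infty'

/-- The function `t ↦ (t + c)⁻¹` for a non-real number `c`. -/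
noncomputable def resolvent (c : ℂ) (hc : c.im ≠ 0) : C₀(ℝ, ℂ) where
  toFun t := ((t : ℂ) + c)⁻¹
  continuous_toFun := by
    refine Continuous.inv₀ (by fun_prop) fun t h => hc ?_
    simpa using congrArg Complex.im h
  zero_at_infty' := by
    refine tendsto_inv₀_cobounded.comp ?_
    rw [← tendsto_norm_atTop_iff_cobounded]
    refine tendsto_atTop_mono (fun t => ?_)
      (tendsto_atTop_add_const_right _ (-‖c‖) (tendsto_norm_cocompact_atTop (E := ℝ)))
    have h1 := norm_sub_norm_le (t : ℂ) (-c)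
    rw [norm_neg, sub_neg_eq_add, Complex.norm_real] at h1
    linarith

theorem resolvent_apply (c : ℂ) (hc : c.im ≠ 0) (t : ℝ) : resolvent c hc t = ((t : ℂ) + c)⁻¹ := rfl

theorem I_im_ne_zero : Complex.I.im ≠ 0 := by simp

theorem neg_I_im_ne_zero : (-Complex.I).im ≠ 0 := by simp

theorem ofReal_add_ne_zero {c : ℂ} (hc : c.im ≠ 0) (t : ℝ) : (t : ℂ) + c ≠ 0 := by
  intro h
  exact hc (by simpa using congrArg Complex.im h)

theorem one_add_pow_ne_zero (t : ℝ) (N : ℕ) : (1 : ℂ) + (t : ℂ) ^ (2 * N) ≠ 0 := by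
  have h : (0 : ℝ) < 1 + t ^ (2 * N) := by
    rw [pow_mul]
    positivity
  exact_mod_cast h.ne'

/-- The function `t ↦ t ^ k / (1 + t ^ (2 * N))` for `k < 2 * N`. -/
noncomputable def powDiv (k N : ℕ) (hk : k < 2 * N) : C₀(ℝ, ℂ) where
  toFun t := (t : ℂ) ^ k / (1 + (t : ℂ) ^ (2 * N))
  continuous_toFun := Continuous.div (by fun_prop) (by fun_prop) fun t => one_add_pow_ne_zero t N
  zero_at_infty' := by
    have h0 : Tendsto (fun t : ℝ => ‖t‖⁻¹) (cocompact ℝ) (𝓝 0) :=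
      tendsto_inv_atTop_zero.comp (tendsto_norm_cocompact_atTop (E := ℝ))
    refine squeeze_zero_norm' ?_ h0
    -- For `|t| ≥ 1` the quotient is at most `1 / |t|`, because `k + 1 ≤ 2 * N`.
    filter_upwards [(tendsto_norm_cocompact_atTop (E := ℝ)).eventually_ge_atTop 1] with t ht
    have h1 : (1 : ℂ) + (t : ℂ) ^ (2 * N) = ((1 + ‖t‖ ^ (2 * N) : ℝ) : ℂ) := by
      rw [pow_mul, pow_mul, Real.norm_eq_abs, sq_abs]
      push_cast
      rfl
    rw [h1, norm_div, norm_pow, Complex.norm_real, Complex.norm_real,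
      Real.norm_of_nonneg (r := 1 + ‖t‖ ^ (2 * N)) (by positivity), div_le_iff₀ (by positivity),
      inv_mul_eq_div, le_div_iff₀ (by positivity), ← pow_succ]
    have := pow_le_pow_right₀ ht (show k + 1 ≤ 2 * N from hk)
    linarith

theorem powDiv_apply (k N : ℕ) (hk : k < 2 * N) (t : ℝ) :
    powDiv k N hk t = (t : ℂ) ^ k / (1 + (t : ℂ) ^ (2 * N)) := rfl

/-- A cutoff function, equal to `1` on `[-n, n]` and vanishing outside `[-n - 1, n + 1]`. -/
noncomputable def cutoffFun (n : ℕ) (t : ℝ) : ℝ := max 0 (min 1 (n + 1 - |t|))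

theorem continuous_cutoffFun (n : ℕ) : Continuous (cutoffFun n) := by
  unfold cutoffFun
  fun_prop

theorem cutoffFun_nonneg (n : ℕ) (t : ℝ) : 0 ≤ cutoffFun n t := le_max_left _ _

theorem cutoffFun_le_one (n : ℕ) (t : ℝ) : cutoffFun n t ≤ 1 :=
  max_le zero_le_one (min_le_left _ _)

theorem cutoffFun_eq_one {n : ℕ} {t : ℝ} (h : |t| ≤ n) : cutoffFun n t = 1 := by
  have : min 1 ((n : ℝ) + 1 - |t|) = 1 := min_eq_left (by linarith)
  rw [cutoffFun, this]
  norm_num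

theorem cutoffFun_eventually_eq_zero (n : ℕ) : ∀ᶠ t in cocompact ℝ, cutoffFun n t = 0 := by
  filter_upwards [(tendsto_norm_cocompact_atTop (E := ℝ)).eventually_ge_atTop (n + 1)] with t ht
  rw [Real.norm_eq_abs] at ht
  exact max_eq_left ((min_le_right _ _).trans (by linarith))

/-- The cutoff functions, as elements of the domain of `muRep`. -/
noncomputable def cutoff (n : ℕ) : muDom where
  val :=
    { toFun := fun t => cutoffFun n t
      continuous_toFun := Complex.continuous_ofReal.comp (continuous_cutoffFun n)
      zero_at_infty' := by
        refine tendsto_const_nhds.congr' ?_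
        filter_upwards [cutoffFun_eventually_eq_zero n] with t ht
        simp [ht] }
  property k := by
    have := continuous_cutoffFun n
    refine ⟨⟨⟨fun t => (t : ℂ) ^ k * cutoffFun n t, by fun_prop⟩, ?_⟩, fun t => rfl⟩
    refine tendsto_const_nhds.congr' ?_
    filter_upwards [cutoffFun_eventually_eq_zero n] with t ht
    simp [ht]

theorem cutoff_apply (n : ℕ) (t : ℝ) : (cutoff n).1 t = cutoffFun n t := rfl

theorem norm_cutoff_le (n : ℕ) : ‖(cutoff n).1‖ ≤ 1 := by
  refine norm_le_of_forall zero_le_one fun t => ?_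
  rw [cutoff_apply, Complex.norm_real, Real.norm_of_nonneg (cutoffFun_nonneg n t)]
  exact cutoffFun_le_one n t

theorem tendsto_cutoff_mul (f : C₀(ℝ, ℂ)) :
    Tendsto (fun n => (cutoff n).1 * f) atTop (𝓝 f) := by
  rw [Metric.tendsto_atTop]
  intro ε hε
  obtain ⟨K, hK, hKf⟩ := mem_cocompact.1
    (f.zero_at_infty' (Metric.ball_mem_nhds (0 : ℂ) (half_pos hε)))
  obtain ⟨R, hR⟩ := hK.isBounded.subset_closedBall (0 : ℝ)
  obtain ⟨n₀, hn₀⟩ := exists_nat_ge R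
  refine ⟨n₀, fun n hn => lt_of_le_of_lt ?_ (half_lt_self hε)⟩
  rw [dist_eq_norm]
  refine norm_le_of_forall (half_pos hε).le fun t => ?_
  rw [sub_apply, mul_apply, cutoff_apply]
  by_cases ht : t ∈ K
  · have h1 : |t| ≤ R := by simpa using hR ht
    have h2 : (n₀ : ℝ) ≤ n := by exact_mod_cast hn
    rw [cutoffFun_eq_one (by linarith)]
    simp [(half_pos hε).le]
  · have h1 : ‖f t‖ < ε / 2 := by simpa using hKf ht
    have h2 : (cutoffFun n t : ℂ) * f t - f t = ((cutoffFun n t - 1 : ℝ) : ℂ) * f t := by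
      push_cast; ring
    rw [h2, norm_mul, Complex.norm_real, Real.norm_of_nonpos (by linarith [cutoffFun_le_one n t])]
    nlinarith [cutoffFun_nonneg n t, cutoffFun_le_one n t, norm_nonneg (f t)]

/-- A function on `ℂ` that takes the value `f t` at `(t + i)⁻¹` for `t ∈ ℝ` and vanishes
at `0`. -/
noncomputable def onCircle (f : C₀(ℝ, ℂ)) (z : ℂ) : ℂ :=
  open scoped Classical in if z = 0 then 0 else f z⁻¹.re

theorem onCircle_zero (f : C₀(ℝ, ℂ)) : onCircle f 0 = 0 := by simp [onCircle]

theorem onCircle_of_ne (f : C₀(ℝ, ℂ)) {z : ℂ} (hz : z ≠ 0) : onCircle f z = f z⁻¹.re := by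
  simp [onCircle, hz]

/-- Only the point `0` needs care. Near it `z⁻¹` is large while its imaginary part stays `1`, so its
real part goes to infinity, where `f` vanishes. -/
theorem continuousOn_onCircle (f : C₀(ℝ, ℂ)) :
    ContinuousOn (onCircle f) {z : ℂ | z = 0 ∨ z⁻¹.im = 1} := by
  intro z hz
  by_cases h0 : z = 0
  · subst h0
    rw [Metric.continuousWithinAt_iff]
    intro ε hε
    obtain ⟨K, hK, hKf⟩ := mem_cocompact.1
      (f.zero_at_infty' (Metric.ball_mem_nhds (0 : ℂ) hε))
    obtain ⟨R, hR⟩ := hK.isBounded.subset_closedBall (0 : ℝ)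
    -- With this radius `‖w⁻¹‖ > |R| + 1`. The imaginary part accounts for `1`, so the real part
    -- exceeds `|R|` in absolute value and lies outside `K`.
    refine ⟨(|R| + 1)⁻¹, by positivity, fun {w} hw hwd => ?_⟩
    rw [onCircle_zero, dist_zero_right]
    by_cases hw0 : w = 0
    · rwa [hw0, onCircle_zero, norm_zero]
    rw [onCircle_of_ne f hw0]
    have hw1 : w⁻¹.im = 1 := hw.resolve_left hw0
    rw [dist_zero_right] at hwd
    have h1 : |R| + 1 < ‖w⁻¹‖ := by
      rw [norm_inv]
      exact (lt_inv_comm₀ (by positivity) (norm_pos_iff.2 hw0)).2 hwd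
    have h2 := Complex.norm_le_abs_re_add_abs_im w⁻¹
    rw [hw1, abs_one] at h2
    have h3 : w⁻¹.re ∉ K := by
      intro h
      have : |w⁻¹.re| ≤ R := by simpa [-Complex.inv_re] using hR h
      linarith [le_abs_self R]
    simpa using hKf h3
  · have h1 : onCircle f =ᶠ[𝓝 z] fun w => f w⁻¹.re := by
      filter_upwards [isOpen_ne.mem_nhds h0] with w hw
      exact onCircle_of_ne f hw
    refine (ContinuousAt.congr ?_ h1.symm).continuousWithinAt
    have h2 : ContinuousAt (fun w : ℂ => w⁻¹.re) z :=
      Complex.continuous_re.continuousAt.comp (continuousAt_inv₀ h0)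
    exact f.continuous_toFun.continuousAt.comp h2

theorem onCircle_resolvent_apply (f : C₀(ℝ, ℂ)) (t : ℝ) :
    onCircle f (resolvent Complex.I I_im_ne_zero t) = f t := by
  rw [resolvent_apply, onCircle_of_ne f (inv_ne_zero (ofReal_add_ne_zero I_im_ne_zero t)), inv_inv]
  simp

theorem onCircle_resolvent {z : ℂ} (hz : z = 0 ∨ z⁻¹.im = 1) :
    onCircle (resolvent Complex.I I_im_ne_zero) z = z := by
  by_cases h0 : z = 0
  · rw [h0, onCircle_zero]
  · rw [onCircle_of_ne _ h0, resolvent_apply]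
    have : ((z⁻¹.re : ℂ) + Complex.I) = z⁻¹ := by
      apply Complex.ext <;> simp [hz.resolve_left h0, -Complex.inv_re, -Complex.inv_im]
    rw [this, inv_inv]

end ZeroAtInftyContinuousMap

/-! ### Functional calculus for an element satisfying the resolvent identity. -/

section lift

open ZeroAtInftyContinuousMap

variable {𝒜 : Type w} [NonUnitalCStarAlgebra 𝒜]

/-- By spectral mapping the relation passes to the points of the quasispectrum: `z - z̄ = -2i |z|²`.
For `z ≠ 0`, division by `|z|²` gives `Im z⁻¹ = 1`. -/
theorem quasispectrum_subset_circle {r : 𝒜} [IsStarNormal r]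
    (hr : r - star r = (-2 * Complex.I) • (r * star r)) :
    quasispectrum ℂ r ⊆ {z : ℂ | z = 0 ∨ z⁻¹.im = 1} := by
  intro z hz
  let g : ℂ → ℂ := fun z => z - star z - (-2 * Complex.I) • (z * star z)
  have h1 : cfcₙ g r = 0 := by
    rw [cfcₙ_sub _ _ r (by fun_prop) (by simp) (by fun_prop) (by simp),
      cfcₙ_smul _ _ r (by fun_prop) (by simp),
      cfcₙ_sub _ _ r (by fun_prop) (by simp) (by fun_prop) (by simp),
      cfcₙ_mul _ _ r (by fun_prop) (by simp) (by fun_prop) (by simp),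
      cfcₙ_star_id r, cfcₙ_id' ℂ r, hr, sub_self]
  have h2 := cfcₙ_map_quasispectrum g r (by fun_prop) (by simp [g])
  rw [h1] at h2
  have h3 : g z ∈ quasispectrum ℂ (0 : 𝒜) := h2 ▸ ⟨z, hz, rfl⟩
  have h3 : g z = 0 := by
    have := NonUnitalIsometricContinuousFunctionalCalculus.norm_quasispectrum_le (𝕜 := ℂ) _ h3
      (IsStarNormal.zero)
    simpa using this
  by_cases h0 : z = 0
  · exact Or.inl h0
  · right
    have h4 : Complex.normSq z ≠ 0 := by simpa using h0
    have h5 := congrArg Complex.im h3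
    rw [Complex.inv_im]
    field_simp
    simp only [g, Complex.sub_im, Complex.star_def, Complex.conj_im, smul_eq_mul, Complex.mul_im,
      Complex.mul_re, Complex.neg_re, Complex.neg_im, Complex.re_ofNat, Complex.im_ofNat,
      Complex.I_re, Complex.I_im, Complex.conj_re, Complex.zero_im] at h5
    rw [Complex.normSq_apply]
    linarith

/-- The homomorphism from `C₀(ℝ)` to a C*-algebra that maps `t ↦ (t + i)⁻¹` to `r`. -/
noncomputable def resolventLift (r : 𝒜) [IsStarNormal r]
    (hr : r - star r = (-2 * Complex.I) • (r * star r)) : C₀(ℝ, ℂ) →⋆ₙₐ[ℂ] 𝒜 :=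
  have hc (f : C₀(ℝ, ℂ)) : ContinuousOn (onCircle f) (quasispectrum ℂ r) :=
    (continuousOn_onCircle f).mono (quasispectrum_subset_circle hr)
  { toFun := fun f => cfcₙ (onCircle f) r
    map_smul' := fun c f => by
      rw [← cfcₙ_smul _ _ r (hc f) (onCircle_zero f)]
      congr 1
      ext z
      by_cases h : z = 0 <;> simp [onCircle, h]
    map_zero' := by
      rw [← cfcₙ_zero ℂ r]
      congr 1
      ext z
      by_cases h : z = 0 <;> simp [onCircle, h]
    map_add' := fun f g => by
      rw [← cfcₙ_add _ _ _ (hc f) (onCircle_zero f) (hc g) (onCircle_zero g)]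
      congr 1
      ext z
      by_cases h : z = 0 <;> simp [onCircle, h]
    map_mul' := fun f g => by
      rw [← cfcₙ_mul _ _ _ (hc f) (onCircle_zero f) (hc g) (onCircle_zero g)]
      congr 1
      ext z
      by_cases h : z = 0 <;> simp [onCircle, h]
    map_star' := fun f => by
      rw [← cfcₙ_star]
      congr 1
      ext z
      by_cases h : z = 0 <;> simp [onCircle, h] }

theorem resolventLift_resolvent (r : 𝒜) [IsStarNormal r]
    (hr : r - star r = (-2 * Complex.I) • (r * star r)) :
    resolventLift r hr (resolvent Complex.I I_im_ne_zero) = r := by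
  change cfcₙ _ r = r
  conv_rhs => rw [← cfcₙ_id' ℂ r]
  exact cfcₙ_congr fun z hz => onCircle_resolvent (quasispectrum_subset_circle hr hz)

end lift

/-! ### The resolvent function generates `C₀(ℝ)`. -/

namespace ZeroAtInftyContinuousMap

/-- Evaluation at a point, as a `*`-homomorphism. -/
noncomputable def evalHom (t : ℝ) : C₀(ℝ, ℂ) →⋆ₙₐ[ℂ] ℂ where
  toFun f := f t
  map_smul' _ _ := rfl
  map_zero' := rfl
  map_add' _ _ := rfl
  map_mul' _ _ := rfl
  map_star' _ := rfl

theorem continuous_evalHom (t : ℝ) : Continuous (evalHom t) :=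
  AddMonoidHomClass.continuous_of_bound (evalHom t) 1 fun f => by
    rw [one_mul]
    exact norm_apply_le f t

/-- The function `t ↦ (t + i)⁻¹` generates the C*-algebra `C₀(ℝ)`. -/
theorem mem_elemental_resolvent (f : C₀(ℝ, ℂ)) :
    f ∈ NonUnitalStarAlgebra.elemental ℂ (resolvent Complex.I I_im_ne_zero) := by
  set r := resolvent Complex.I I_im_ne_zero with hr
  have hn : IsStarNormal r := ⟨mul_comm _ _⟩
  have hr' : r - star r = (-2 * Complex.I) • (r * star r) := by
    ext t
    have h1 := ofReal_add_ne_zero (c := Complex.I) (by simp) t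
    have h2 := ofReal_add_ne_zero (c := -Complex.I) (by simp) t
    have h3 : star r t = ((t : ℂ) + -Complex.I)⁻¹ := by
      rw [star_apply, hr, resolvent_apply]
      simp
    rw [sub_apply, smul_apply, mul_apply, h3, hr, resolvent_apply]
    rw [inv_sub_inv h1 h2, smul_eq_mul, div_eq_mul_inv, mul_inv]
    ring
  -- Evaluation at `t` is a continuous `*`-homomorphism and commutes with the functional calculus.
  -- The claim thus reduces to `onCircle f` at the number `(t + i)⁻¹`.
  have key : cfcₙ (onCircle f) r = f := by
    ext t
    have hc := (continuousOn_onCircle f).mono (quasispectrum_subset_circle hr')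
    have h1 := (evalHom t).map_cfcₙ (onCircle f) r hc (onCircle_zero f) (continuous_evalHom t)
    change (cfcₙ (onCircle f) r) t = cfcₙ (onCircle f) (r t) at h1
    have h2 : ContinuousOn (onCircle f) (quasispectrum ℂ (r t)) :=
      hc.mono (NonUnitalAlgHom.quasispectrum_apply_subset' (R := ℂ) ℂ (evalHom t) r)
    rw [h1, cfcₙ_eq_cfc h2 (onCircle_zero f)]
    have := cfc_algebraMap (A := ℂ) (r t) (onCircle f)
    simp only [Algebra.algebraMap_self, RingHom.id_apply] at this
    rw [this]
    exact onCircle_resolvent_apply f t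
  rw [← key]
  exact cfcₙ_mem_elemental _ _

end ZeroAtInftyContinuousMap

/-! ### Algebraic operations on `muDom`. -/

theorem muMul_mul (p : ℂ[X]) (f g : muDom) : (muMul p f).1 * g.1 = f.1 * (muMul p g).1 := by
  ext t
  simp only [ZeroAtInftyContinuousMap.mul_apply, muMul_apply]
  ring

theorem eval_star (p : ℂ[X]) (t : ℝ) : (star p).eval (t : ℂ) = star (p.eval (t : ℂ)) := by
  rw [Polynomial.star_def_complex]
  conv_lhs => rw [← Complex.conj_ofReal t]
  exact Polynomial.eval_map_apply (starRingEnd ℂ) (t : ℂ)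

/-- The complex conjugate of a function in `muDom`. -/
noncomputable def muStar (f : muDom) : muDom where
  val := star f.1
  property n := by
    obtain ⟨g, hg⟩ := f.2 n
    exact ⟨star g, fun t => by simp [hg]⟩

theorem star_muMul (p : ℂ[X]) (f : muDom) :
    star (muMul p f).1 = (muMul (star p) (muStar f)).1 := by
  ext t
  simp [muMul_apply, eval_star, muStar]

/-- The product of a function in `muDom` with a function in `C₀(ℝ)`. -/
noncomputable def muMulRight (f : muDom) (g : C₀(ℝ, ℂ)) : muDom where
  val := f.1 * g
  property n := by
    obtain ⟨k, hk⟩ := f.2 n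
    exact ⟨k * g, fun t => by simp [hk, mul_assoc]⟩

theorem muMul_muMulRight (p : ℂ[X]) (f : muDom) (g : C₀(ℝ, ℂ)) :
    (muMul p (muMulRight f g)).1 = (muMul p f).1 * g := by
  ext t
  simp [muMul_apply, muMulRight, mul_assoc]

/-! ### The operators induced by polynomials. -/

namespace CStarRep

open ZeroAtInftyContinuousMap

variable {D : Type u} {E : Type v} [NonUnitalCStarAlgebra D] [NormedAddCommGroup E]
  [NormedSpace ℂ E] [HilbertModule D E] (ρ : CStarRep C₀(ℝ, ℂ) D E)

theorem map_mul_apply {B : Type w} [NonUnitalCStarAlgebra B] (ρ : CStarRep B D E) (f g : B)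
    (x : E) : ρ.toHom (f * g) x = ρ.toHom f (ρ.toHom g x) := by
  rw [map_mul]; rfl

theorem map_add_apply {B : Type w} [NonUnitalCStarAlgebra B] (ρ : CStarRep B D E) (f g : B)
    (x : E) : ρ.toHom (f + g) x = ρ.toHom f x + ρ.toHom g x := by
  rw [map_add]; rfl

theorem map_smul_apply {B : Type w} [NonUnitalCStarAlgebra B] (ρ : CStarRep B D E) (c : ℂ) (f : B)
    (x : E) : ρ.toHom (c • f) x = c • ρ.toHom f x := by
  rw [map_smul]; rfl

theorem continuous_toHom_apply {B : Type w} [NonUnitalCStarAlgebra B] (ρ : CStarRep B D E) (x : E) :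
    Continuous fun b => ρ.toHom b x :=
  AddMonoidHomClass.continuous_of_bound (ρ.actionMap.flip x) ‖x‖ fun b => by
    rw [mul_comm]
    exact ρ.norm_map_le b x

theorem map_comm_apply (f g : C₀(ℝ, ℂ)) (x : E) :
    ρ.toHom f (ρ.toHom g x) = ρ.toHom g (ρ.toHom f x) := by
  rw [← map_mul_apply, mul_comm, map_mul_apply]

/-- On vectors `ρ b x` this is convergence of the cutoffs as an approximate unit of `C₀(ℝ)`. The
operators are uniformly bounded by `1`, so it extends to the closed span, which is everything by
nondegeneracy. -/
theorem tendsto_cutoff (x : E) :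
    Tendsto (fun n => ρ.toHom (cutoff n).1 x) atTop (𝓝 x) := by
  let S : Set E := {x | Tendsto (fun n => ρ.toHom (cutoff n).1 x) atTop (𝓝 x)}
  have hS : (Submodule.span ℂ {z : E | ∃ b x, ρ.toHom b x = z} : Set E) ⊆ S := by
    intro z hz
    induction hz using Submodule.span_induction with
    | mem z hz =>
      obtain ⟨b, x, rfl⟩ := hz
      have := ((ρ.continuous_toHom_apply x).tendsto b).comp (tendsto_cutoff_mul b)
      refine this.congr fun n => ?_
      exact ρ.map_mul_apply _ _ _
    | zero => simp [S]
    | add a b _ _ ha hb => simpa [S] using Tendsto.add ha hb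
    | smul c a _ ha => simpa [S] using Tendsto.const_smul ha c
  have hclosed : IsClosed S := by
    refine isClosed_of_closure_subset fun x hx => ?_
    change Tendsto _ _ _
    rw [Metric.tendsto_atTop]
    intro ε hε
    obtain ⟨y, hy, hxy⟩ := Metric.mem_closure_iff.1 hx (ε / 3) (by positivity)
    obtain ⟨N, hN⟩ := Metric.tendsto_atTop.1 hy (ε / 3) (by positivity)
    refine ⟨N, fun n hn => ?_⟩
    have h1 := hN n hn
    have h2 : dist (ρ.toHom (cutoff n).1 x) (ρ.toHom (cutoff n).1 y) ≤ dist x y := by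
      rw [dist_eq_norm, dist_eq_norm, ← map_sub]
      refine (ρ.norm_map_le _ _).trans ?_
      exact mul_le_of_le_one_left (norm_nonneg _) (norm_cutoff_le n)
    have h3 := dist_triangle4 (ρ.toHom (cutoff n).1 x) (ρ.toHom (cutoff n).1 y) y x
    rw [dist_comm y x] at h3
    linarith
  exact closure_minimal hS hclosed (ρ.nondegenerate x)

/-- The functions in `muDom` separate vectors because the cutoffs are among them. This makes each
relation `multGraph p` single-valued. -/
theorem eq_of_forall_muDom {x y : E} (h : ∀ f : muDom, ρ.toHom f.1 x = ρ.toHom f.1 y) : x = y :=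
  tendsto_nhds_unique ((ρ.tendsto_cutoff x).congr fun _ => h _) (ρ.tendsto_cutoff y)

/-- The graph of the operator on `E` induced by multiplication with the polynomial function `p`. -/
def multGraph (p : ℂ[X]) : Submodule ℂ (E × E) where
  carrier := {v | ∀ f : muDom, ρ.toHom (muMul p f).1 v.1 = ρ.toHom f.1 v.2}
  zero_mem' f := by simp
  add_mem' {v w} hv hw f := by
    simp only [Prod.fst_add, Prod.snd_add, map_add, hv f, hw f]
  smul_mem' c v hv f := by
    simp only [Prod.smul_fst, Prod.smul_snd, map_smul, hv f]

theorem isClosed_multGraph (p : ℂ[X]) : IsClosed (ρ.multGraph p : Set (E × E)) := by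
  have : (ρ.multGraph p : Set (E × E))
      = ⋂ f : muDom, {v : E × E | ρ.toHom (muMul p f).1 v.1 = ρ.toHom f.1 v.2} := by
    ext v
    simp [multGraph]
  rw [this]
  exact isClosed_iInter fun f => isClosed_eq (by fun_prop) (by fun_prop)

theorem multGraph_unique {p : ℂ[X]} {x y z : E} (hy : (x, y) ∈ ρ.multGraph p)
    (hz : (x, z) ∈ ρ.multGraph p) : y = z :=
  ρ.eq_of_forall_muDom fun f => (hy f).symm.trans (hz f)

theorem mem_multGraph_muDom (p : ℂ[X]) (f : muDom) (x : E) :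
    (ρ.toHom f.1 x, ρ.toHom (muMul p f).1 x) ∈ ρ.multGraph p := by
  intro g
  rw [← map_mul_apply, ← map_mul_apply, muMul_mul]

theorem mem_multGraph_one {x y : E} : (x, y) ∈ ρ.multGraph 1 ↔ x = y := by
  have h (f : muDom) : muMul 1 f = f := by
    ext t
    simp [muMul_apply]
  constructor
  · intro hxy
    refine ρ.eq_of_forall_muDom fun f => ?_
    have := hxy f
    rwa [h] at this
  · rintro rfl f
    rw [h]

/-- The defining condition for `p` is applied to the test function `q f`, which is again in `muDom`.
-/
theorem multGraph_mul {p q : ℂ[X]} {x y z : E} (h : (x, y) ∈ ρ.multGraph p)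
    (h' : (y, z) ∈ ρ.multGraph q) : (x, z) ∈ ρ.multGraph (p * q) := by
  intro f
  have : muMul (p * q) f = muMul p (muMul q f) := by
    ext t
    simp [muMul_apply, mul_assoc]
  rw [this, h, h']

theorem multGraph_add {p q : ℂ[X]} {x y z : E} (h : (x, y) ∈ ρ.multGraph p)
    (h' : (x, z) ∈ ρ.multGraph q) : (x, y + z) ∈ ρ.multGraph (p + q) := by
  intro f
  have : (muMul (p + q) f).1 = (muMul p f).1 + (muMul q f).1 := by
    ext t
    simp [muMul_apply, add_mul]
  rw [this, map_add_apply, h, h', map_add]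

theorem multGraph_smul {p : ℂ[X]} {x y : E} (c : ℂ) (h : (x, y) ∈ ρ.multGraph p) :
    (x, c • y) ∈ ρ.multGraph (c • p) := by
  intro f
  have : (muMul (c • p) f).1 = c • (muMul p f).1 := by
    ext t
    simp [muMul_apply, mul_assoc]
  rw [this, map_smul_apply, h, map_smul]

theorem mem_multGraph_cutoff {p : ℂ[X]} {x y : E} (h : (x, y) ∈ ρ.multGraph p) (n : ℕ) :
    ρ.toHom (muMul p (cutoff n)).1 x = ρ.toHom (cutoff n).1 y := h _

/-- The representation `μ ⊗_ρ 1` consists of the operators induced by multiplication with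
polynomials, on their common domain. -/
theorem mem_range_graphMap_induced {v : ℂ[X] → E} :
    v ∈ LinearMap.range (muRep.induced ρ).graphMap ↔ ∀ p, (v 1, v p) ∈ ρ.multGraph p := by
  rw [UnboundedRep.induced, UnboundedRep.range_graphMap_tensor]
  constructor
  · intro hv p
    let S : Submodule ℂ (ℂ[X] → E) := (ρ.multGraph p).comap
      ((LinearMap.proj 1).prod (LinearMap.proj p))
    have hS : IsClosed (S : Set (ℂ[X] → E)) :=
      (ρ.isClosed_multGraph p).preimage (by fun_prop : Continuous fun v : ℂ[X] → E => (v 1, v p))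
    refine Submodule.topologicalClosure_minimal _ ?_ hS hv
    rw [Submodule.span_le]
    rintro _ ⟨f, x, rfl⟩
    have h1 : muRep.π 1 f = f := by simp
    change (ρ.toHom (muRep.π 1 f).1 x, ρ.toHom (muRep.π p f).1 x) ∈ ρ.multGraph p
    rw [h1]
    exact ρ.mem_multGraph_muDom p f x
  · intro hv
    -- Cutting off `v 1` approximates all coordinates at once, since `p` times the cutoff applied to
    -- `v 1` is the cutoff applied to `v p`.
    have hlim : Tendsto (fun n : ℕ => fun p => ρ.actionMap (muRep.π p (cutoff n)) (v 1)) atTop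
        (𝓝 v) := by
      rw [tendsto_pi_nhds]
      intro p
      refine (ρ.tendsto_cutoff (v p)).congr fun n => ?_
      exact (ρ.mem_multGraph_cutoff (hv p) n).symm
    exact mem_closure_of_tendsto hlim (Eventually.of_forall fun n =>
      Submodule.subset_span ⟨cutoff n, v 1, rfl⟩)

theorem mem_induced_graph {x : E} (hx : x ∈ (muRep.induced ρ).dom) (p : ℂ[X]) :
    (x, ((muRep.induced ρ).π p ⟨x, hx⟩ : E)) ∈ ρ.multGraph p := by
  have := ρ.mem_range_graphMap_induced.1 ⟨⟨x, hx⟩, rfl⟩ p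
  rwa [UnboundedRep.graphMap_one] at this

/-- The conditions for different `p` are independent of each other, so separately chosen images
already form a point of the graph. -/
theorem mem_induced_dom {x : E} :
    x ∈ (muRep.induced ρ).dom ↔ ∀ p, ∃ y, (x, y) ∈ ρ.multGraph p := by
  constructor
  · exact fun hx p => ⟨_, ρ.mem_induced_graph hx p⟩
  · intro h
    choose v hv using h
    have h1 : v 1 = x := (ρ.mem_multGraph_one.1 (hv 1)).symm
    rw [UnboundedRep.mem_dom_iff]
    refine ⟨v, ?_, h1⟩
    rw [mem_range_graphMap_induced, h1]
    exact hv

/-- The vectors `ρ (cutoff n) x` lie in the domain of every polynomial, and cutting off both entries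
of a pair in `multGraph p` again gives such a pair. The common domain is therefore a core for each
`multGraph p`. -/
theorem graph_closure_induced_op (p : ℂ[X]) :
    ((muRep.induced ρ).op p).closure.graph = ρ.multGraph p := by
  rw [UnboundedRep.graph_closure_op]
  apply le_antisymm
  · refine Submodule.topologicalClosure_minimal _ ?_ (ρ.isClosed_multGraph p)
    rintro z hz
    obtain ⟨x, rfl⟩ := (UnboundedRep.mem_op_graph_iff _ _ _).1 hz
    exact ρ.mem_induced_graph x.2 p
  · rintro ⟨x, y⟩ hxy
    have hlim := (ρ.tendsto_cutoff x).prodMk_nhds (ρ.tendsto_cutoff y)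
    refine mem_closure_of_tendsto hlim (Eventually.of_forall fun n => ?_)
    have hd : ρ.toHom (cutoff n).1 x ∈ (muRep.induced ρ).dom :=
      ρ.mem_induced_dom.2 fun q => ⟨_, ρ.mem_multGraph_muDom q _ x⟩
    refine (UnboundedRep.mem_op_graph_iff _ _ _).2 ⟨⟨_, hd⟩, Prod.ext rfl ?_⟩
    rw [← ρ.mem_multGraph_cutoff hxy n]
    exact ρ.multGraph_unique (ρ.mem_induced_graph hd p) (ρ.mem_multGraph_muDom p _ x)

theorem isClosed_induced [CompleteSpace E] : (muRep.induced ρ).IsClosed := by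
  rw [UnboundedRep.isClosed_iff_isClosed_range, UnboundedRep.induced, UnboundedRep.tensor,
    UnboundedRep.range_graphMap_closure]
  exact Submodule.isClosed_topologicalClosure _

theorem dense_domain_of_graph_eq {t : E →ₗ.[ℂ] E} {p : ℂ[X]} (ht : t.graph = ρ.multGraph p) :
    Dense (t.domain : Set E) := fun x =>
  mem_closure_of_tendsto (ρ.tendsto_cutoff x) (Eventually.of_forall fun n =>
    LinearPMap.mem_domain_of_mem_graph (ht ▸ ρ.mem_multGraph_muDom p (cutoff n) x))

/-- One inclusion tests the adjoint on the vectors `ρ (star f) w` of the domain, which recovers the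
relation for `star p`. The other moves `p` across the inner product after a cutoff and removes the
cutoff in the limit. -/
theorem graph_adjoint_of_graph_eq {t : E →ₗ.[ℂ] E} {p : ℂ[X]} (ht : t.graph = ρ.multGraph p) :
    (HilbertModule.adjoint D t).graph = ρ.multGraph (star p) := by
  ext ⟨y, z⟩
  rw [HilbertModule.mem_adjoint_graph D t (ρ.dense_domain_of_graph_eq ht)]
  constructor
  · intro h f
    refine HilbertModule.eq_of_dense (D := D) dense_univ fun w _ => ?_
    have h1 : (ρ.toHom (muStar f).1 w, ρ.toHom (muMul p (muStar f)).1 w) ∈ t.graph :=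
      ht ▸ ρ.mem_multGraph_muDom p _ w
    obtain ⟨x, hx⟩ := (LinearPMap.mem_graph_iff' _).1 h1
    obtain ⟨hx1, hx2⟩ := Prod.ext_iff.1 hx
    have h2 := h x
    change (x : E) = _ at hx1
    change t x = _ at hx2
    rw [hx1, hx2] at h2
    rw [ρ.inner_map_right, ρ.inner_map_right, star_muMul, star_star]
    exact h2
  · intro h x
    have hx : ((x : E), t x) ∈ ρ.multGraph p := ht ▸ t.mem_graph x
    have h1 (n : ℕ) : inner D (ρ.toHom (cutoff n).1 (t x)) y
        = inner D (ρ.toHom (cutoff n).1 (x : E)) z := by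
      rw [← hx, ρ.inner_map_left, star_muMul, h, ρ.inner_map_left]
      rfl
    have h2 := ((HilbertModule.continuous_inner_left (D := D) y).tendsto _).comp
      (ρ.tendsto_cutoff (t x))
    have h3 := ((HilbertModule.continuous_inner_left (D := D) z).tendsto _).comp
      (ρ.tendsto_cutoff (x : E))
    exact tendsto_nhds_unique (h2.congr h1) h3

theorem isSelfAdjointOp_of_graph_eq {t : E →ₗ.[ℂ] E} {p : ℂ[X]} (ht : t.graph = ρ.multGraph p)
    (hp : IsSelfAdjoint p) : HilbertModule.IsSelfAdjointOp D t := by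
  refine ⟨ρ.dense_domain_of_graph_eq ht, LinearPMap.eq_of_eq_graph ?_⟩
  rw [ρ.graph_adjoint_of_graph_eq ht, hp.star_eq, ht]

/-- The quotient of `f` by `1 + |p|²`, for `f` in `muDom`. -/
noncomputable def _root_.muDiv (p : ℂ[X]) (f : muDom) : muDom :=
  have hc : Continuous fun t : ℝ => (((1 + ‖p.eval (t : ℂ)‖ ^ 2)⁻¹ : ℝ) : ℂ) := by
    refine Complex.continuous_ofReal.comp (Continuous.inv₀ ?_ fun t => by positivity)
    have := p.continuous
    fun_prop
  have hb (t : ℝ) : ‖(((1 + ‖p.eval (t : ℂ)‖ ^ 2)⁻¹ : ℝ) : ℂ)‖ ≤ 1 := by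
    rw [Complex.norm_real, Real.norm_of_nonneg (by positivity)]
    exact inv_le_one_of_one_le₀ (by nlinarith [sq_nonneg ‖p.eval (t : ℂ)‖])
  { val := boundedMul _ hc 1 hb f.1
    property := fun n => by
      obtain ⟨g, hg⟩ := f.2 n
      refine ⟨boundedMul _ hc 1 hb g, fun t => ?_⟩
      change _ * g t = _ * (_ * f.1 t)
      rw [hg]
      ring }

theorem _root_.muDiv_apply (p : ℂ[X]) (f : muDom) (t : ℝ) :
    (muDiv p f).1 t = (((1 + ‖p.eval (t : ℂ)‖ ^ 2)⁻¹ : ℝ) : ℂ) * f.1 t := rfl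

theorem _root_.muDiv_add (p : ℂ[X]) (f : muDom) :
    (muDiv p f).1 + (muMul (star p) (muMul p (muDiv p f))).1 = f.1 := by
  ext t
  have h : (1 + (‖p.eval (t : ℂ)‖ : ℂ) ^ 2) ≠ 0 := by
    have : (0 : ℝ) < 1 + ‖p.eval (t : ℂ)‖ ^ 2 := by positivity
    exact_mod_cast this.ne'
  rw [ZeroAtInftyContinuousMap.add_apply, muMul_apply, muMul_apply, muDiv_apply, eval_star,
    ← mul_assoc, Complex.star_def, ← Complex.normSq_eq_conj_mul_self, Complex.normSq_eq_norm_sq]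
  push_cast
  field_simp

/-- Here `t* t` acts as multiplication by `|p|²`, so `ρ (cutoff n) x` is the image under `1 + t* t`
of the vector obtained from the cutoff divided by `1 + |p|²`. -/
theorem isRegular_of_graph_eq {t : E →ₗ.[ℂ] E} {p : ℂ[X]} (ht : t.graph = ρ.multGraph p) :
    HilbertModule.IsRegular D t := by
  have hadj := ρ.graph_adjoint_of_graph_eq ht
  refine ⟨ρ.dense_domain_of_graph_eq ht, ?_, ρ.dense_domain_of_graph_eq hadj, fun x => ?_⟩
  · rw [LinearPMap.IsClosed, ht]
    exact ρ.isClosed_multGraph p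
  · refine mem_closure_of_tendsto (ρ.tendsto_cutoff x) (Eventually.of_forall fun n => ?_)
    set f := muDiv p (cutoff n)
    have h1 : (ρ.toHom f.1 x, ρ.toHom (muMul (star p) (muMul p f)).1 x)
        ∈ (HilbertModule.compOp (HilbertModule.adjoint D t) t).graph := by
      rw [HilbertModule.mem_compOp_graph, ht, hadj]
      exact ⟨_, ρ.mem_multGraph_muDom p f x, ρ.mem_multGraph_muDom (star p) (muMul p f) x⟩
    obtain ⟨y, hy⟩ := (LinearPMap.mem_graph_iff' _).1 h1
    obtain ⟨hy1, hy2⟩ := Prod.ext_iff.1 hy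
    change (y : E) = _ at hy1
    change HilbertModule.compOp (HilbertModule.adjoint D t) t y = _ at hy2
    refine ⟨y, ?_⟩
    rw [hy1, hy2, ← map_add_apply, muDiv_add]

/-- Lower powers on the domain of the operator induced by `X ^ N`. -/
theorem mem_multGraph_pow_of_lt {k N : ℕ} (hk : k < N) {x z : E}
    (h : (x, z) ∈ ρ.multGraph (Polynomial.X ^ N)) :
    (x, ρ.toHom (powDiv k N (by omega)) x + ρ.toHom (powDiv (k + N) N (by omega)) z)
      ∈ ρ.multGraph (Polynomial.X ^ k) := by
  intro f
  have h1 : ρ.toHom (powDiv (k + N) N (by omega)) (ρ.toHom f.1 z)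
      = ρ.toHom (powDiv (k + N) N (by omega) * (muMul (Polynomial.X ^ N) f).1) x := by
    rw [← h f, map_mul_apply]
  rw [map_add, map_comm_apply, map_comm_apply ρ f.1 _ z, h1, ← map_mul_apply, ← map_add_apply]
  congr 2
  -- What remains is `t^k (1 + t^(2N)) = t^k + t^(k+N) t^N`, multiplied by `f` and divided by `1 +
  -- t^(2N)`.
  ext t
  have := one_add_pow_ne_zero t N
  simp only [muMul_apply, Polynomial.eval_pow, Polynomial.eval_X,
    ZeroAtInftyContinuousMap.add_apply, ZeroAtInftyContinuousMap.mul_apply, powDiv_apply]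
  field_simp
  ring

theorem graph_powOp_of_graph_eq {t : E →ₗ.[ℂ] E} (ht : t.graph = ρ.multGraph Polynomial.X)
    (n : ℕ) : (HilbertModule.powOp t n).graph = ρ.multGraph (Polynomial.X ^ n) := by
  induction n with
  | zero =>
    ext ⟨x, y⟩
    rw [pow_zero, mem_multGraph_one, LinearPMap.mem_graph_iff']
    constructor
    · rintro ⟨z, hz⟩
      obtain ⟨rfl, rfl⟩ := Prod.ext_iff.1 hz
      rfl
    · rintro rfl
      exact ⟨⟨x, trivial⟩, rfl⟩
  | succ n ih =>
    ext ⟨x, z⟩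
    rw [HilbertModule.powOp, HilbertModule.mem_compOp_graph, ih, ht, pow_succ]
    constructor
    · rintro ⟨y, h1, h2⟩
      exact ρ.multGraph_mul h1 h2
    · intro h
      -- The intermediate vector for `X ^ n` comes from the bound on lower powers with `k = n` and
      -- `N = n + 1`; it is what puts `x` in the natural domain of the composite.
      have h1 := ρ.mem_multGraph_pow_of_lt (Nat.lt_succ_self n) (by rwa [pow_succ])
      refine ⟨_, h1, fun f => ?_⟩
      rw [← h1, ← h f]
      congr 2
      ext s
      simp [muMul_apply, mul_assoc]

end CStarRep

/-! ### Resolvents and isometric intertwiners. -/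

namespace CStarRep

open ZeroAtInftyContinuousMap

section resolvent

variable {D : Type u} {E : Type v} [NonUnitalCStarAlgebra D] [NormedAddCommGroup E]
  [NormedSpace ℂ E] [HilbertModule D E] (ρ : CStarRep C₀(ℝ, ℂ) D E)

/-- The operator `ρ ((t + c)⁻¹)` is the resolvent of the operator induced by `X`. -/
theorem mem_multGraph_X_iff {c : ℂ} (hc : c.im ≠ 0) {x y : E} :
    (x, y) ∈ ρ.multGraph Polynomial.X ↔ ρ.toHom (resolvent c hc) (y + c • x) = x := by
  have key (f : muDom) : (muMul Polynomial.X f).1 * resolvent c hc + c • (f.1 * resolvent c hc)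
      = f.1 := by
    ext t
    have := ofReal_add_ne_zero hc t
    simp only [muMul_apply, Polynomial.eval_X, ZeroAtInftyContinuousMap.add_apply,
      ZeroAtInftyContinuousMap.mul_apply, ZeroAtInftyContinuousMap.smul_apply, resolvent_apply,
      smul_eq_mul]
    field_simp
  constructor
  · intro h
    refine ρ.eq_of_forall_muDom fun f => ?_
    -- Testing with `f / (t + c)` brings in the resolvent; `key` then reassembles `f`.
    have h1 := h (muMulRight f (resolvent c hc))
    rw [muMul_muMulRight] at h1
    conv_rhs => rw [← key f]
    rw [map_add_apply, map_smul_apply, h1, ← map_mul_apply, map_add, map_smul]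
    rfl
  · intro h f
    have h1 : ρ.toHom ((muMul Polynomial.X f).1 + c • f.1) x = ρ.toHom f.1 (y + c • x) := by
      conv_lhs => rw [← h]
      rw [← map_mul_apply, add_mul, smul_mul_assoc, key]
    rw [map_add_apply, map_smul_apply, map_add, map_smul] at h1
    exact add_right_cancel h1

theorem resolvent_mem_multGraph {c : ℂ} (hc : c.im ≠ 0) (x : E) :
    (ρ.toHom (resolvent c hc) x, x - c • ρ.toHom (resolvent c hc) x)
      ∈ ρ.multGraph Polynomial.X := by
  rw [mem_multGraph_X_iff ρ hc, sub_add_cancel]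

end resolvent

section isometry

variable {D : Type u} {E₁ E₂ : Type v} [NonUnitalCStarAlgebra D]
  [NormedAddCommGroup E₁] [NormedSpace ℂ E₁] [HilbertModule D E₁]
  [NormedAddCommGroup E₂] [NormedSpace ℂ E₂] [HilbertModule D E₂]

theorem _root_.IsHilbertIsometry.continuous {I : E₁ →ₗ[ℂ] E₂} (hI : IsHilbertIsometry D I) :
    Continuous I := by
  refine AddMonoidHomClass.continuous_of_bound I 1 fun x => ?_
  rw [one_mul]
  refine (sq_le_sq₀ (norm_nonneg _) (norm_nonneg _)).1 ?_
  rw [HilbertModule.norm_sq_eq (D := D), HilbertModule.norm_sq_eq (D := D), hI.2]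

variable (ρ₁ : CStarRep C₀(ℝ, ℂ) D E₁) (ρ₂ : CStarRep C₀(ℝ, ℂ) D E₂) {I : E₁ →ₗ[ℂ] E₂}

/-- The functions `f` such that `I` intertwines both `f` and `star f` form a closed `*`-subalgebra,
and the resolvent function generates `C₀(ℝ)`. Both relations are imposed because `I` may fail to be
adjointable, so neither follows from the other by taking adjoints. -/
theorem intertwines_of_resolvent (hI : Continuous I)
    (h : ∀ x, I (ρ₁.toHom (resolvent Complex.I I_im_ne_zero) x)
      = ρ₂.toHom (resolvent Complex.I I_im_ne_zero) (I x))
    (h' : ∀ x, I (ρ₁.toHom (star (resolvent Complex.I I_im_ne_zero)) x)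
      = ρ₂.toHom (star (resolvent Complex.I I_im_ne_zero)) (I x)) (f : C₀(ℝ, ℂ)) (x : E₁) :
    I (ρ₁.toHom f x) = ρ₂.toHom f (I x) := by
  let S : NonUnitalStarSubalgebra ℂ C₀(ℝ, ℂ) :=
    { carrier := {f | ∀ x, I (ρ₁.toHom f x) = ρ₂.toHom f (I x) ∧
        I (ρ₁.toHom (star f) x) = ρ₂.toHom (star f) (I x)}
      add_mem' := fun {f g} hf hg x => by
        simp only [star_add, map_add_apply, map_add I, hf x, hg x, and_self]
      zero_mem' := fun x => by simp
      mul_mem' := fun {f g} hf hg x => by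
        simp only [star_mul, map_mul_apply, (hf _).1, (hf _).2, (hg _).1, (hg _).2, and_self]
      smul_mem' := fun c f hf x => by
        simp only [star_smul, map_smul_apply, map_smul I, hf x, and_self]
      star_mem' := fun {f} hf x => ⟨(hf x).2, by rw [star_star]; exact (hf x).1⟩ }
  have hS : IsClosed (S : Set C₀(ℝ, ℂ)) := by
    have : (S : Set C₀(ℝ, ℂ)) = ⋂ x, {f | I (ρ₁.toHom f x) = ρ₂.toHom f (I x)} ∩
        {f | I (ρ₁.toHom (star f) x) = ρ₂.toHom (star f) (I x)} := by
      ext f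
      simp only [Set.mem_iInter]
      exact Iff.rfl
    rw [this]
    refine isClosed_iInter fun x => (isClosed_eq ?_ ?_).inter (isClosed_eq ?_ ?_)
    · exact hI.comp (ρ₁.continuous_toHom_apply x)
    · exact ρ₂.continuous_toHom_apply _
    · exact hI.comp ((ρ₁.continuous_toHom_apply x).comp continuous_star)
    · exact (ρ₂.continuous_toHom_apply _).comp continuous_star
  exact (NonUnitalStarAlgebra.elemental.le_of_mem hS (fun x => ⟨h x, h' x⟩)
    (mem_elemental_resolvent f) x).1

theorem star_resolvent_I : star (resolvent Complex.I I_im_ne_zero)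
    = resolvent (-Complex.I) neg_I_im_ne_zero := by
  ext t
  simp [resolvent_apply]

theorem intertwines_iff (hI : IsHilbertIsometry D I) :
    (∀ f x, I (ρ₁.toHom f x) = ρ₂.toHom f (I x)) ↔
      (muRep.induced ρ₁).IsIntertwiner (muRep.induced ρ₂) I := by
  constructor
  · intro h x
    have key (p : ℂ[X]) (y z : E₁) (hyz : (y, z) ∈ ρ₁.multGraph p) :
        (I y, I z) ∈ ρ₂.multGraph p := by
      intro f
      rw [← h, ← h, hyz]
    have hx : I x ∈ (muRep.induced ρ₂).dom :=
      ρ₂.mem_induced_dom.2 fun p => ⟨_, key p _ _ (ρ₁.mem_induced_graph x.2 p)⟩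
    refine ⟨hx, fun p => ?_⟩
    exact ρ₂.multGraph_unique (key p _ _ (ρ₁.mem_induced_graph x.2 p)) (ρ₂.mem_induced_graph hx p)
  · intro h
    -- The hypothesis concerns only the common domain. This is a core for `multGraph X`, so
    -- continuity of `I` and closedness of the target relation extend it.
    have key : ∀ z ∈ ρ₁.multGraph Polynomial.X, (I z.1, I z.2) ∈ ρ₂.multGraph Polynomial.X := by
      have hc : IsClosed {z : E₁ × E₁ | (I z.1, I z.2) ∈ ρ₂.multGraph Polynomial.X} :=
        (ρ₂.isClosed_multGraph _).preimage
          ((hI.continuous.comp continuous_fst).prodMk (hI.continuous.comp continuous_snd))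
      intro z hz
      rw [← graph_closure_induced_op, UnboundedRep.graph_closure_op] at hz
      refine closure_minimal (fun z hz => ?_) hc hz
      obtain ⟨x, rfl⟩ := (UnboundedRep.mem_op_graph_iff _ _ _).1 hz
      obtain ⟨hx, hx'⟩ := h x
      change (I x, I ((muRep.induced ρ₁).π Polynomial.X x)) ∈ ρ₂.multGraph Polynomial.X
      rw [hx']
      exact ρ₂.mem_induced_graph hx _
    have key' {c : ℂ} (hc : c.im ≠ 0) (x : E₁) :
        I (ρ₁.toHom (resolvent c hc) x) = ρ₂.toHom (resolvent c hc) (I x) := by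
      have := (ρ₂.mem_multGraph_X_iff hc).1 (key _ (ρ₁.resolvent_mem_multGraph hc x))
      dsimp only at this
      rw [map_sub, map_smul, sub_add_cancel] at this
      exact this.symm
    refine intertwines_of_resolvent ρ₁ ρ₂ hI.continuous (key' _) ?_
    rw [star_resolvent_I]
    exact key' _

theorem ext_toHom {B : Type w} {E : Type v} [NonUnitalCStarAlgebra B] [NormedAddCommGroup E]
    [NormedSpace ℂ E] [HilbertModule D E] {ρ σ : CStarRep B D E}
    (h : ∀ b x, ρ.toHom b x = σ.toHom b x) : ρ = σ := by
  obtain ⟨f, _, _⟩ := ρ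
  obtain ⟨g, _, _⟩ := σ
  have : f = g := by
    ext b x
    exact h b x
  subst this
  rfl

/-- If two representations induce the same one, the identity isometry intertwines the latter, hence
also the former. -/
theorem injective_induced {E : Type v} [NormedAddCommGroup E]
    [NormedSpace ℂ E] [HilbertModule D E] :
    Function.Injective fun ρ : CStarRep C₀(ℝ, ℂ) D E => muRep.induced ρ := by
  intro ρ σ h
  dsimp only at h
  have h1 : IsHilbertIsometry D (LinearMap.id : E →ₗ[ℂ] E) := ⟨fun _ _ => rfl, fun _ _ => rfl⟩
  refine ext_toHom ((intertwines_iff ρ σ h1).2 ?_)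
  rw [← h]
  exact fun x => ⟨x.2, fun _ => rfl⟩

end isometry

/-- The canonical representation `μ` is induced by the identity representation of `C₀(ℝ)`. -/
theorem induced_self : muRep.induced (CStarRep.self C₀(ℝ, ℂ)) = muRep := by
  refine UnboundedRep.ext_graph ?_
  ext v
  rw [mem_range_graphMap_induced]
  constructor
  · intro h
    have key (p : ℂ[X]) (t : ℝ) : v p t = p.eval (t : ℂ) * v 1 t := by
      -- A cutoff equal to `1` at `t` turns the tested relation into a pointwise identity at `t`.
      obtain ⟨n, hn⟩ := exists_nat_ge |t|
      have h1 : (muMul p (cutoff n)).1 * v 1 = (cutoff n).1 * v p := h p (cutoff n)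
      have h2 := congrArg (fun f : C₀(ℝ, ℂ) => f t) h1
      simp only [ZeroAtInftyContinuousMap.mul_apply, muMul_apply, cutoff_apply,
        cutoffFun_eq_one hn] at h2
      simpa using h2.symm
    have hv : v 1 ∈ muDom := fun n => ⟨v (Polynomial.X ^ n), fun t =>
      (key _ t).trans (by simp only [Polynomial.eval_pow, Polynomial.eval_X])⟩
    refine ⟨⟨v 1, hv⟩, ?_⟩
    ext p t
    exact (key p t).symm
  · rintro ⟨f, rfl⟩ p g
    rw [UnboundedRep.graphMap_one]
    change (muMul p g).1 * f.1 = g.1 * (muMul p f).1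
    exact muMul_mul p g f

end CStarRep

/-! ### The C*-algebra of adjointable operators. -/

namespace HilbertModule

variable (D : Type u) (E : Type v) [NonUnitalCStarAlgebra D]
  [NormedAddCommGroup E] [NormedSpace ℂ E] [HilbertModule D E]

/-- The algebra of adjointable operators on a Hilbert module. -/
def adjointable : Subalgebra ℂ (E →L[ℂ] E) where
  carrier := {S | ∃ S' : E →L[ℂ] E, ∀ x y, inner D (S x) y = inner D x (S' y)}
  mul_mem' := by
    rintro S T ⟨S', hS⟩ ⟨T', hT⟩
    exact ⟨T' * S', fun x y => by simp [hS, hT]⟩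
  add_mem' := by
    rintro S T ⟨S', hS⟩ ⟨T', hT⟩
    exact ⟨S' + T', fun x y => by simp [hS, hT, inner_add_left, inner_add_right]⟩
  algebraMap_mem' c := ⟨algebraMap ℂ _ (star c), fun x y => by
    simp [Algebra.algebraMap_eq_smul_one, inner_smul_left, inner_smul_right]⟩

variable {D E}

namespace adjointable

/-- The adjoint of an adjointable operator. -/
noncomputable instance : Star (adjointable D E) where
  star S := ⟨S.2.choose, S.1, fun x y => by
    rw [← star_inner, ← S.2.choose_spec, star_inner]⟩

theorem inner_left (S : adjointable D E) (x y : E) :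
    inner D (S.1 x) y = inner D x ((star S).1 y) :=
  S.2.choose_spec x y

theorem ext_inner {S T : adjointable D E}
    (h : ∀ x y, inner D x (S.1 y) = inner D x (T.1 y)) : S = T := by
  ext y
  exact eq_of_dense (D := D) dense_univ fun x _ => h x y

theorem star_eq_of_inner {S T : adjointable D E}
    (h : ∀ x y, inner D (S.1 x) y = inner D x (T.1 y)) : star S = T :=
  ext_inner fun x y => by rw [← inner_left, h]

noncomputable instance : StarRing (adjointable D E) where
  star_involutive S := star_eq_of_inner fun x y => by
    rw [← star_inner, ← inner_left, star_inner]
  star_mul S T := star_eq_of_inner fun x y => by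
    change inner D (S.1 (T.1 x)) y = inner D x ((star T).1 ((star S).1 y))
    rw [inner_left, inner_left]
  star_add S T := star_eq_of_inner fun x y => by
    change inner D (S.1 x + T.1 x) y = inner D x ((star S).1 y + (star T).1 y)
    rw [inner_add_left, inner_add_right, inner_left, inner_left]

instance : StarModule ℂ (adjointable D E) where
  star_smul c S := star_eq_of_inner fun x y => by
    change inner D (c • S.1 x) y = inner D x (star c • (star S).1 y)
    rw [inner_smul_left, inner_smul_right, inner_left]

/-- By the Cauchy–Schwarz inequality, `‖S x‖² = ‖⟨x, S* S x⟩‖ ≤ ‖S* S‖ ‖x‖²`. -/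
instance : CStarRing (adjointable D E) where
  norm_mul_self_le S := by
    have h : ‖S‖ ≤ √‖star S * S‖ := by
      refine S.1.opNorm_le_bound (Real.sqrt_nonneg _) fun x => ?_
      refine (sq_le_sq₀ (norm_nonneg _) (by positivity)).1 ?_
      rw [mul_pow, Real.sq_sqrt (norm_nonneg (star S * S)), norm_sq_eq (D := D), inner_left]
      calc ‖inner D x ((star S).1 (S.1 x))‖ ≤ ‖x‖ * ‖(star S * S).1 x‖ := norm_inner_le _ _
        _ ≤ ‖x‖ * (‖star S * S‖ * ‖x‖) :=
          mul_le_mul_of_nonneg_left ((star S * S).1.le_opNorm x) (norm_nonneg _)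
        _ = _ := by ring
    rw [← sq]
    exact (Real.le_sqrt (norm_nonneg _) (norm_nonneg _)).1 h

/-- The C*-identity makes the involution isometric. Hence the adjoints of a Cauchy sequence are
Cauchy too, and the two limits are adjoint to each other. -/
instance [CompleteSpace E] : CompleteSpace (adjointable D E) := by
  refine Metric.complete_of_cauchySeq_tendsto fun S hS => ?_
  have hS' : CauchySeq fun n => star (S n) := by
    rw [Metric.cauchySeq_iff] at hS ⊢
    intro ε hε
    obtain ⟨N, hN⟩ := hS ε hε
    refine ⟨N, fun m hm n hn => ?_⟩
    have h : star (S m) - star (S n) = star (S m - S n) := (star_sub _ _).symm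
    rw [dist_eq_norm, h]
    exact (norm_star (S m - S n)).trans_lt (dist_eq_norm (S m) (S n) ▸ hN m hm n hn)
  obtain ⟨T, hT⟩ := cauchySeq_tendsto_of_complete (u := fun n => (S n).1)
    (hS.map uniformContinuous_subtype_val)
  obtain ⟨T', hT'⟩ := cauchySeq_tendsto_of_complete (u := fun n => (star (S n)).1)
    (hS'.map uniformContinuous_subtype_val)
  have h : ∀ x y, inner D (T x) y = inner D x (T' y) := by
    intro x y
    have h1 : Tendsto (fun n => (S n).1 x) atTop (𝓝 (T x)) :=
      ((ContinuousLinearMap.apply ℂ E x).continuous.tendsto _).comp hT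
    have h2 : Tendsto (fun n => (star (S n)).1 y) atTop (𝓝 (T' y)) :=
      ((ContinuousLinearMap.apply ℂ E y).continuous.tendsto _).comp hT'
    have h3 := ((continuous_inner_left (D := D) y).tendsto _).comp h1
    have h4 := ((continuous_inner_right (D := D) x).tendsto _).comp h2
    exact tendsto_nhds_unique (h3.congr fun n => inner_left (S n) x y) h4
  exact ⟨⟨T, T', h⟩, tendsto_subtype_rng.2 hT⟩

noncomputable instance [CompleteSpace E] : CStarAlgebra (adjointable D E) where

end adjointable

/-! ### Resolvents and functional calculus of a regular self-adjoint operator. -/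

section resolvent

variable {t : E →ₗ.[ℂ] E}

theorem IsSelfAdjointOp.inner_eq (ht : IsSelfAdjointOp D t) {x y x' y' : E}
    (h : (x, y) ∈ t.graph) (h' : (x', y') ∈ t.graph) : inner D y x' = inner D x y' := by
  obtain ⟨z, hz⟩ := (LinearPMap.mem_graph_iff' _).1 h
  obtain ⟨rfl, rfl⟩ := Prod.ext_iff.1 hz
  rw [← ht.2, mem_adjoint_graph D t ht.1] at h'
  exact h' z

/-- The cross terms cancel because `t` is symmetric and `c` is imaginary. It bounds both `x` and `t
x` by `(t + c) x`. -/
theorem IsSelfAdjointOp.inner_add_smul (ht : IsSelfAdjointOp D t) {c : ℂ} (hc : star c = -c)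
    (hc' : c * c = -1) {x y : E} (h : (x, y) ∈ t.graph) :
    inner D x x + inner D y y = inner D (y + c • x) (y + c • x) := by
  have h1 := ht.inner_eq h h
  rw [inner_add_left, inner_add_right, inner_add_right, inner_smul_left, inner_smul_left,
    inner_smul_right, inner_smul_right, h1, hc, smul_smul, neg_mul, hc', neg_neg, one_smul]
  module

/-- The resolvents of a regular self-adjoint operator at `i` and `-i`. -/
theorem exists_resolvent [CompleteSpace E] (hr : IsRegular D t) (ht : IsSelfAdjointOp D t) {c : ℂ}
    (hc : star c = -c) (hc' : c * c = -1) :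
    ∃ r : E →L[ℂ] E, (∀ z, (r z, z - c • r z) ∈ t.graph) ∧
      ∀ x y, (x, y) ∈ t.graph → r (y + c • x) = x := by
  let L : t.graph →L[ℂ] E :=
    (ContinuousLinearMap.snd ℂ E E + c • ContinuousLinearMap.fst ℂ E E).comp t.graph.subtypeL
  have hL (v : t.graph) : L v = v.1.2 + c • v.1.1 := rfl
  have hfst (v : t.graph) : ‖v.1.1‖ ≤ ‖L v‖ :=
    norm_le_of_inner_add (D := D) (ht.inner_add_smul hc hc' v.2)
  have hsnd (v : t.graph) : ‖v.1.2‖ ≤ ‖L v‖ :=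
    norm_le_of_inner_add (D := D) (by
      rw [_root_.add_comm (inner D v.1.2 v.1.2)]
      exact ht.inner_add_smul hc hc' v.2)
  -- The map `t + c` on the graph is bounded below. The graph is complete because `t` is closed, so
  -- the range is closed.
  have hanti : AntilipschitzWith 1 L := L.antilipschitz_of_bound fun v => by
    rw [NNReal.coe_one, one_mul]
    exact max_le (hfst v) (hsnd v)
  have hcomplete : CompleteSpace t.graph := hr.2.1.completeSpace_coe
  have hclosed : IsClosed (Set.range L) := hanti.isClosed_range L.uniformContinuous
  have hdense : Dense (Set.range L) := by
    refine hr.2.2.2.mono ?_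
    rintro _ ⟨x, rfl⟩
    have hx := (compOp (adjoint D t) t).mem_graph x
    rw [mem_compOp_graph] at hx
    obtain ⟨y, h1, h2⟩ := hx
    replace h2 := LinearPMap.le_graph_of_le ht.2.le h2
    -- Since `c² = -1`, we have `1 + t² = (t + c)(t - c)`. The range of `t + c` therefore contains
    -- that of `1 + t* t`, which is dense by regularity.
    refine ⟨⟨(y, compOp (adjoint D t) t x) - c • ((x : E), y),
      t.graph.sub_mem h2 (t.graph.smul_mem c h1)⟩, ?_⟩
    rw [hL]
    change compOp (adjoint D t) t x - c • y + c • (y - c • (x : E)) = _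
    rw [smul_sub, smul_smul, hc']
    module
  have hsurj : Function.Surjective L := by
    rw [← Set.range_eq_univ, ← hclosed.closure_eq]
    exact hdense.closure_eq
  let e : t.graph ≃ₗ[ℂ] E := LinearEquiv.ofBijective L.toLinearMap ⟨hanti.injective, hsurj⟩
  have he (z : E) : L (e.symm z) = z := e.apply_symm_apply z
  let r : E →L[ℂ] E := LinearMap.mkContinuous
    ((LinearMap.fst ℂ E E).comp (t.graph.subtype.comp e.symm.toLinearMap)) 1 fun z => by
      rw [one_mul]
      have := hfst (e.symm z)
      rwa [he] at this
  have hr (z : E) : r z = (e.symm z).1.1 := rfl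
  refine ⟨r, fun z => ?_, fun x y h => ?_⟩
  · have h1 := he z
    rw [hL] at h1
    have h2 : z - c • r z = (e.symm z).1.2 := by
      rw [hr, sub_eq_iff_eq_add]
      exact h1.symm
    rw [h2]
    exact (e.symm z).2
  · have : e.symm (y + c • x) = ⟨(x, y), h⟩ := e.symm_apply_eq.2 rfl
    rw [hr, this]

end resolvent

end HilbertModule

open HilbertModule ZeroAtInftyContinuousMap in
/-- The functional calculus of a regular self-adjoint operator `t`. -/
theorem CStarRep.exists_multGraph_eq {D : Type u} {E : Type v} [NonUnitalCStarAlgebra D]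
    [NormedAddCommGroup E] [NormedSpace ℂ E] [CompleteSpace E] [HilbertModule D E]
    {t : E →ₗ.[ℂ] E} (hr : IsRegular D t) (ht : IsSelfAdjointOp D t) :
    ∃ ρ : CStarRep C₀(ℝ, ℂ) D E, t.graph = ρ.multGraph Polynomial.X := by
  obtain ⟨r, hr1, hr2⟩ := exists_resolvent hr ht (c := Complex.I) (by simp) (by simp)
  obtain ⟨s, hs1, hs2⟩ := exists_resolvent hr ht (c := -Complex.I) (by simp) (by simp)
  -- Symmetry of `t` is applied to `r x` and `s y`; the terms `i ⟨r x, s y⟩` on the two sides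
  -- cancel.
  have hrs (x y : E) : inner D (r x) y = inner D x (s y) := by
    have h := ht.inner_eq (hr1 x) (hs1 y)
    rw [HilbertModule.inner_sub_left, HilbertModule.inner_sub_right, HilbertModule.inner_smul_left,
      HilbertModule.inner_smul_right, Complex.star_def, Complex.conj_I] at h
    exact (sub_left_inj.1 h).symm
  have hsr (x y : E) : inner D (s x) y = inner D x (r y) := by
    rw [← star_inner, ← hrs, star_inner]
  let R : adjointable D E := ⟨r, s, hrs⟩
  let S : adjointable D E := ⟨s, r, hsr⟩
  have hRS : star R = S := adjointable.star_eq_of_inner hrs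
  have h1 : R - S = (-2 * Complex.I) • (R * S) := by
    ext z
    change r z - s z = (-2 * Complex.I) • r (s z)
    -- Applying `r` to `(t + i)(s z) = z + 2i s z` gives the resolvent identity.
    have := hr2 _ _ (hs1 z)
    rw [map_add, map_sub, map_smul, map_smul] at this
    linear_combination (norm := module) this
  have h2 : R - S = (-2 * Complex.I) • (S * R) := by
    ext z
    change r z - s z = (-2 * Complex.I) • s (r z)
    have := hs2 _ _ (hr1 z)
    rw [map_add, map_sub, map_smul, map_smul] at this
    linear_combination (norm := module) (-1 : ℂ) • this
  -- The two orders of the resolvent identity have the same left side, so `R` and `S` commute.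
  have hn : IsStarNormal R := ⟨by
    rw [hRS]
    have : (-2 * Complex.I) • (S * R) = (-2 * Complex.I) • (R * S) := h2.symm.trans h1
    exact smul_right_injective _ (by simp) this⟩
  have hR : R - star R = (-2 * Complex.I) • (R * star R) := by rw [hRS, h1]
  let φ : C₀(ℝ, ℂ) →⋆ₙₐ[ℂ] adjointable D E := resolventLift R hR
  have hφ : φ (resolvent Complex.I I_im_ne_zero) = R := resolventLift_resolvent R hR
  let ρ : CStarRep C₀(ℝ, ℂ) D E :=
    { toHom :=
        { toFun := fun f => (φ f).1
          map_smul' := fun c f => by rw [map_smul]; rfl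
          map_zero' := by rw [map_zero]; rfl
          map_add' := fun f g => by rw [map_add]; rfl
          map_mul' := fun f g => by rw [map_mul]; rfl }
      inner_map_left := fun f x y => by
        change inner D ((φ f).1 x) y = inner D x ((φ (star f)).1 y)
        rw [map_star, adjointable.inner_left]
      nondegenerate := by
        -- Every `x` in the dense domain of `t` is `r ((t + i) x)`.
        refine hr.1.mono fun x hx => Submodule.subset_span ?_
        refine ⟨resolvent Complex.I I_im_ne_zero, t ⟨x, hx⟩ + Complex.I • x, ?_⟩
        change (φ _).1 _ = x
        rw [hφ]
        exact hr2 _ _ (t.mem_graph ⟨x, hx⟩) }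
  have hρ (x : E) : ρ.toHom (resolvent Complex.I I_im_ne_zero) x = r x := by
    change (φ _).1 x = r x
    rw [hφ]
  refine ⟨ρ, ?_⟩
  ext ⟨x, y⟩
  rw [ρ.mem_multGraph_X_iff I_im_ne_zero, hρ]
  refine ⟨hr2 x y, fun h => ?_⟩
  have := hr1 (y + Complex.I • x)
  rwa [h, _root_.add_sub_cancel_right] at this

/-! ### Interior tensor products of representations. -/

namespace CStarRep

section tensor

open TensorProduct

variable {B : Type w} {D₁ : Type u₁} {D₂ : Type u₂} {E : Type v₁} {F : Type v₂}
    {T : Type v₃} [NonUnitalCStarAlgebra B]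
    [NonUnitalCStarAlgebra D₁] [NonUnitalCStarAlgebra D₂]
    [NormedAddCommGroup E] [NormedSpace ℂ E] [HilbertModule D₁ E]
    [NormedAddCommGroup F] [NormedSpace ℂ F] [HilbertModule D₂ F]
    [NormedAddCommGroup T] [NormedSpace ℂ T] [HilbertModule D₂ T]
    (ρ : CStarRep B D₁ E) {φ : CStarRep D₁ D₂ F} {τ : E →ₗ[ℂ] F →ₗ[ℂ] T}

/-- Every `c` with `‖c‖ < 1` in a C*-algebra satisfies `1 - c* c = (1 - s)²` for some
self-adjoint `s`. -/
theorem _root_.exists_add_sub_mul_self_eq {c : B} (hc : ‖c‖ < 1) :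
    ∃ s : B, star s = s ∧ s + s - s * s = star c * c := by
  let _ := CStarAlgebra.spectralOrder B
  have := CStarAlgebra.spectralOrderedRing B
  have hd : IsSelfAdjoint (star c * c) := IsSelfAdjoint.star_mul_self c
  let g : ℝ → ℝ := fun t => 1 - √(1 - t)
  have hg : Continuous g := by fun_prop
  have hg0 : g 0 = 0 := by simp [g]
  refine ⟨cfcₙ g (star c * c), (IsSelfAdjoint.cfcₙ (f := g) (a := star c * c)).star_eq, ?_⟩
  rw [← cfcₙ_mul _ _ _ (by fun_prop) hg0 (by fun_prop) hg0,
    ← cfcₙ_add _ _ _ (by fun_prop) hg0 (by fun_prop) hg0,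
    ← cfcₙ_sub _ _ _ (by fun_prop) (by simp [hg0]) (by fun_prop) (by simp [hg0])]
  conv_rhs => rw [← cfcₙ_id' ℝ (star c * c)]
  refine cfcₙ_congr fun t ht => ?_
  have h2 : ‖t‖ ≤ ‖star c * c‖ :=
    NonUnitalIsometricContinuousFunctionalCalculus.norm_quasispectrum_le (𝕜 := ℝ) _ ht
  rw [CStarRing.norm_star_mul_self] at h2
  have h3 : t ≤ 1 := (le_abs_self t).trans (h2.trans (by nlinarith [norm_nonneg c]))
  have h4 := Real.mul_self_sqrt (show 0 ≤ 1 - t by linarith)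
  simp only [g]
  linear_combination -h4

/-- The canonical map from the algebraic tensor product `E ⊙ F` to `T`. -/
noncomputable def tensorLift (τ : E →ₗ[ℂ] F →ₗ[ℂ] T) : E ⊗[ℂ] F →ₗ[ℂ] T := TensorProduct.lift τ

theorem denseRange_tensorLift (h : IsInteriorTensor φ τ) : DenseRange (tensorLift τ) := by
  refine h.dense_span.mono ?_
  have : Submodule.span ℂ {z : T | ∃ x y, τ x y = z} ≤ LinearMap.range (tensorLift τ) := by
    rw [Submodule.span_le]
    rintro _ ⟨x, y, rfl⟩
    exact ⟨x ⊗ₜ y, rfl⟩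
  exact this

/-- The operator `ρ b ⊗ 1` on the algebraic tensor product `E ⊙ F`. -/
noncomputable def tensorAct (b : B) (F : Type v₂) [AddCommGroup F]
    [Module ℂ F] : E ⊗[ℂ] F →ₗ[ℂ] E ⊗[ℂ] F :=
  (ρ.actionMap b).rTensor F

theorem tensorAct_tmul (b : B) (x : E) (y : F) :
    ρ.tensorAct b F (x ⊗ₜ y) = ρ.toHom b x ⊗ₜ y := rfl

theorem tensorAct_mul (a b : B) (s : E ⊗[ℂ] F) :
    ρ.tensorAct (a * b) F s = ρ.tensorAct a F (ρ.tensorAct b F s) := by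
  induction s with
  | zero => simp
  | add s t hs ht => simp only [map_add, hs, ht]
  | tmul x y => simp only [tensorAct_tmul, map_mul_apply]

theorem tensorAct_add (a b : B) (s : E ⊗[ℂ] F) :
    ρ.tensorAct (a + b) F s = ρ.tensorAct a F s + ρ.tensorAct b F s := by
  simp only [tensorAct, map_add, LinearMap.rTensor_add, LinearMap.add_apply]

theorem tensorAct_smul (c : ℂ) (b : B) (s : E ⊗[ℂ] F) :
    ρ.tensorAct (c • b) F s = c • ρ.tensorAct b F s := by
  simp only [tensorAct, map_smul, LinearMap.rTensor_smul, LinearMap.smul_apply]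

theorem tensorAct_sub (a b : B) (s : E ⊗[ℂ] F) :
    ρ.tensorAct (a - b) F s = ρ.tensorAct a F s - ρ.tensorAct b F s := by
  simp only [tensorAct, map_sub, LinearMap.rTensor_sub, LinearMap.sub_apply]

theorem inner_tensorAct (h : IsInteriorTensor φ τ) (b : B)
    (s t : E ⊗[ℂ] F) :
    inner D₂ (tensorLift τ (ρ.tensorAct b F s)) (tensorLift τ t)
      = inner D₂ (tensorLift τ s) (tensorLift τ (ρ.tensorAct (star b) F t)) := by
  induction s with
  | zero => simp only [map_zero, HilbertModule.inner_zero_left]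
  | add s s' hs hs' => simp only [map_add, HilbertModule.inner_add_left, hs, hs']
  | tmul x y =>
    induction t with
    | zero => simp only [map_zero, HilbertModule.inner_zero_right]
    | add s s' hs hs' => simp only [map_add, HilbertModule.inner_add_right, hs, hs']
    | tmul x' y' =>
      simp only [tensorAct_tmul, tensorLift, TensorProduct.lift.tmul, h.inner_eq,
        ρ.inner_map_left]

/-- For `‖c‖ < 1` write `1 - c* c = (1 - s)²` with `s` self-adjoint. Then `⟨c v, c v⟩ + ⟨(1 - s) v,
(1 - s) v⟩ = ⟨v, v⟩` holds on the algebraic tensor product, so `c ⊗ 1` is contractive there. -/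
theorem norm_tensorAct_le (h : IsInteriorTensor φ τ) (b : B)
    (v : E ⊗[ℂ] F) : ‖tensorLift τ (ρ.tensorAct b F v)‖ ≤ (‖b‖ + 1) * ‖tensorLift τ v‖ := by
  have key : ∀ c : B, ‖c‖ < 1 → ‖tensorLift τ (ρ.tensorAct c F v)‖ ≤ ‖tensorLift τ v‖ := by
    intro c hc
    obtain ⟨s, hs, hsc⟩ := exists_add_sub_mul_self_eq hc
    refine HilbertModule.norm_le_of_inner_add (D := D₂)
      (y := tensorLift τ v - tensorLift τ (ρ.tensorAct s F v)) ?_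
    have e1 : inner D₂ (tensorLift τ (ρ.tensorAct c F v)) (tensorLift τ (ρ.tensorAct c F v))
        = inner D₂ (tensorLift τ v) (tensorLift τ (ρ.tensorAct (s + s - s * s) F v)) := by
      rw [inner_tensorAct ρ h, ← tensorAct_mul, hsc]
    have e2 : inner D₂ (tensorLift τ (ρ.tensorAct s F v)) (tensorLift τ (ρ.tensorAct s F v))
        = inner D₂ (tensorLift τ v) (tensorLift τ (ρ.tensorAct (s * s) F v)) := by
      rw [inner_tensorAct ρ h, ← tensorAct_mul, hs]
    have e3 : inner D₂ (tensorLift τ (ρ.tensorAct s F v)) (tensorLift τ v)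
        = inner D₂ (tensorLift τ v) (tensorLift τ (ρ.tensorAct s F v)) := by
      rw [inner_tensorAct ρ h, hs]
    rw [e1, tensorAct_sub, tensorAct_add, map_sub, map_add]
    simp only [HilbertModule.inner_sub_left, HilbertModule.inner_sub_right,
      HilbertModule.inner_add_right, e2, e3]
    abel
  -- Dividing by `‖b‖ + 1` makes the norm strictly less than `1`, also for `b = 0`; boundedness
  -- suffices, so the constant need not be sharp.
  have hr0 : 0 < ‖b‖ + 1 := by positivity
  have h1 := key ((((‖b‖ + 1 : ℝ) : ℂ)⁻¹) • b) (by
    rw [norm_smul, norm_inv, Complex.norm_real, Real.norm_of_nonneg hr0.le, inv_mul_lt_one₀ hr0]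
    linarith)
  rwa [tensorAct_smul, map_smul, norm_smul, norm_inv, Complex.norm_real,
    Real.norm_of_nonneg hr0.le, inv_mul_le_iff₀ hr0] at h1

theorem ext_tensorLift (h : IsInteriorTensor φ τ) {S S' : T →L[ℂ] T}
    (hS : ∀ v, S (tensorLift τ v) = S' (tensorLift τ v)) : S = S' :=
  ContinuousLinearMap.ext fun x => congrFun
    ((denseRange_tensorLift h).equalizer S.continuous S'.continuous (funext hS)) x

variable [CompleteSpace T]

/-- The operator `ρ b ⊗ 1` on the interior tensor product. -/
noncomputable def tensorOp (τ : E →ₗ[ℂ] F →ₗ[ℂ] T) (b : B) : T →L[ℂ] T :=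
  LinearMap.extendOfNorm ((tensorLift τ).comp (ρ.tensorAct b F)) (tensorLift τ)

theorem tensorOp_apply (h : IsInteriorTensor φ τ) (b : B) (v : E ⊗[ℂ] F) :
    ρ.tensorOp τ b (tensorLift τ v) = tensorLift τ (ρ.tensorAct b F v) :=
  LinearMap.extendOfNorm_eq (denseRange_tensorLift h) ⟨_, ρ.norm_tensorAct_le h b⟩ v

theorem tensorOp_tmul (h : IsInteriorTensor φ τ) (b : B) (x : E) (y : F) :
    ρ.tensorOp τ b (τ x y) = τ (ρ.toHom b x) y :=
  ρ.tensorOp_apply h b (x ⊗ₜ y)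

/-- The representation `ρ ⊗ 1` on the interior tensor product. -/
noncomputable def tensor (h : IsInteriorTensor φ τ) : CStarRep B D₂ T where
  toHom :=
    { toFun := ρ.tensorOp τ
      map_smul' := fun c b => ext_tensorLift h fun v => by
        rw [tensorOp_apply ρ h, tensorAct_smul, map_smul, ← tensorOp_apply ρ h]
        rfl
      map_zero' := ext_tensorLift h fun v => by
        rw [tensorOp_apply ρ h]
        simp [tensorAct]
      map_add' := fun a b => ext_tensorLift h fun v => by
        rw [tensorOp_apply ρ h, tensorAct_add, map_add, ← tensorOp_apply ρ h, ← tensorOp_apply ρ h]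
        rfl
      map_mul' := fun a b => ext_tensorLift h fun v => by
        rw [tensorOp_apply ρ h, tensorAct_mul, ← tensorOp_apply ρ h, ← tensorOp_apply ρ h]
        rfl }
  inner_map_left b x y := by
    change inner D₂ (ρ.tensorOp τ b x) y = inner D₂ x (ρ.tensorOp τ (star b) y)
    have h1 (s : E ⊗[ℂ] F) : inner D₂ (ρ.tensorOp τ b (tensorLift τ s)) y
        = inner D₂ (tensorLift τ s) (ρ.tensorOp τ (star b) y) := by
      refine congrFun ((denseRange_tensorLift h).equalizer
        (g := fun y => inner D₂ (ρ.tensorOp τ b (tensorLift τ s)) y)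
        (h := fun y => inner D₂ (tensorLift τ s) (ρ.tensorOp τ (star b) y))
        (HilbertModule.continuous_inner_right _)
        ((HilbertModule.continuous_inner_right _).comp (ρ.tensorOp τ (star b)).continuous)
        (funext fun t => ?_)) y
      simp only [Function.comp_apply, tensorOp_apply ρ h, inner_tensorAct ρ h]
    exact congrFun ((denseRange_tensorLift h).equalizer
        (g := fun x => inner D₂ (ρ.tensorOp τ b x) y)
        (h := fun x => inner D₂ x (ρ.tensorOp τ (star b) y))
        ((HilbertModule.continuous_inner_left _).comp (ρ.tensorOp τ b).continuous)
        (HilbertModule.continuous_inner_left _) (funext h1)) x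
  nondegenerate := by
    set N := Submodule.span ℂ {z : T | ∃ b x, ρ.tensorOp τ b x = z} with hN
    have key : {z : T | ∃ x y, τ x y = z} ⊆ N.topologicalClosure := by
      rintro _ ⟨x, y, rfl⟩
      have h1 : Set.MapsTo (fun x => τ x y)
          (Submodule.span ℂ {z : E | ∃ b x, ρ.toHom b x = z}) N := by
        have : Submodule.span ℂ {z : E | ∃ b x, ρ.toHom b x = z} ≤ N.comap (τ.flip y) := by
          rw [Submodule.span_le]
          rintro _ ⟨b, x, rfl⟩
          exact Submodule.subset_span ⟨b, τ x y, ρ.tensorOp_tmul h b x y⟩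
        exact this
      exact map_mem_closure (f := fun x => τ x y) (UnboundedRep.tensor_continuous h y) (ρ.nondegenerate x) h1
    have h2 : N.topologicalClosure = ⊤ := by
      rw [eq_top_iff, ← Submodule.dense_iff_topologicalClosure_eq_top.1 h.dense_span]
      exact Submodule.topologicalClosure_minimal _ (Submodule.span_le.2 key)
        (Submodule.isClosed_topologicalClosure _)
    exact Submodule.dense_iff_topologicalClosure_eq_top.2 h2

theorem tensor_tmul (h : IsInteriorTensor φ τ) (b : B) (x : E) (y : F) :
    (ρ.tensor h).toHom b (τ x y) = τ (ρ.toHom b x) y :=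
  ρ.tensorOp_tmul h b x y

/-- Both graphs are closed spans, so each inclusion is checked on spanning vectors. In one direction
`ρ f x` with `f` in `muDom` lies in the domain of `Φ(ρ)`; in the other the `multGraph` relations
hold on elementary tensors. -/
theorem induced_tensor (h : IsInteriorTensor φ τ) (ρ : CStarRep C₀(ℝ, ℂ) D₁ E) :
    muRep.induced (ρ.tensor h) = (muRep.induced ρ).tensor h := by
  refine UnboundedRep.ext_graph (le_antisymm ?_ ?_)
  · rw [UnboundedRep.induced, UnboundedRep.range_graphMap_tensor]
    have hclosed : IsClosed (LinearMap.range ((muRep.induced ρ).tensor h).graphMap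
        : Set (ℂ[X] → T)) := by
      rw [UnboundedRep.range_graphMap_tensor]
      exact Submodule.isClosed_topologicalClosure _
    refine Submodule.topologicalClosure_minimal _ (Submodule.span_le.2 ?_) hclosed
    rintro _ ⟨f, z, rfl⟩
    -- For fixed `f` the spanning vector depends linearly and continuously on `z`, so `z` may be
    -- taken to be an elementary tensor.
    let G : T →ₗ[ℂ] (ℂ[X] → T) :=
      LinearMap.pi fun p => ((ρ.tensor h).toHom (muMul p f).1).toLinearMap
    have hG : Continuous G := continuous_pi fun p => ((ρ.tensor h).toHom (muMul p f).1).continuous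
    have hspan : Submodule.span ℂ {z : T | ∃ x y, τ x y = z}
        ≤ (LinearMap.range ((muRep.induced ρ).tensor h).graphMap).comap G := by
      rw [Submodule.span_le]
      rintro _ ⟨x, y, rfl⟩
      change G (τ x y) ∈ LinearMap.range _
      rw [UnboundedRep.range_graphMap_tensor]
      apply Submodule.le_topologicalClosure
      apply Submodule.subset_span
      have hd : ρ.toHom f.1 x ∈ (muRep.induced ρ).dom :=
        ρ.mem_induced_dom.2 fun q => ⟨_, ρ.mem_multGraph_muDom q f x⟩
      refine ⟨⟨_, hd⟩, y, funext fun p => ?_⟩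
      rw [← ρ.multGraph_unique (ρ.mem_multGraph_muDom p f x) (ρ.mem_induced_graph hd p)]
      exact ρ.tensor_tmul h _ x y
    exact (hclosed.preimage hG).closure_subset_iff.2 hspan (h.dense_span z)
  · rw [UnboundedRep.range_graphMap_tensor]
    have hclosed : IsClosed (LinearMap.range (muRep.induced (ρ.tensor h)).graphMap
        : Set (ℂ[X] → T)) := by
      rw [UnboundedRep.induced, UnboundedRep.range_graphMap_tensor]
      exact Submodule.isClosed_topologicalClosure _
    refine Submodule.topologicalClosure_minimal _ (Submodule.span_le.2 ?_) hclosed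
    rintro _ ⟨x, y, rfl⟩
    rw [SetLike.mem_coe, mem_range_graphMap_induced]
    intro p f
    have h1 := ρ.mem_induced_graph x.2 p f
    rw [map_one]
    change (ρ.tensor h).toHom _ (τ x y) = (ρ.tensor h).toHom _ (τ ((muRep.induced ρ).π p x) y)
    rw [tensor_tmul, tensor_tmul, h1]

end tensor

end CStarRep

/-! ### Recognising induced representations. -/

namespace ZeroAtInftyContinuousMap

theorem norm_powDiv_le (k N : ℕ) (hk : k < 2 * N) : ‖powDiv k N hk‖ ≤ 1 := by
  refine norm_le_of_forall zero_le_one fun t => ?_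
  have h1 : (1 : ℂ) + (t : ℂ) ^ (2 * N) = ((1 + ‖t‖ ^ (2 * N) : ℝ) : ℂ) := by
    rw [pow_mul, pow_mul, Real.norm_eq_abs, sq_abs]
    push_cast
    rfl
  rw [powDiv_apply, h1, norm_div, norm_pow, Complex.norm_real, Complex.norm_real,
    Real.norm_of_nonneg (r := 1 + ‖t‖ ^ (2 * N)) (by positivity), div_le_one (by positivity)]
  have h2 : 0 ≤ ‖t‖ ^ (2 * N) := by positivity
  rcases le_total ‖t‖ 1 with ht | ht
  · linarith [pow_le_one₀ (n := k) (norm_nonneg t) ht]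
  · linarith [pow_le_pow_right₀ ht hk.le]

end ZeroAtInftyContinuousMap

namespace CStarRep

open ZeroAtInftyContinuousMap

variable {D : Type u} {E : Type v} [NonUnitalCStarAlgebra D] [NormedAddCommGroup E]
  [NormedSpace ℂ E] [HilbertModule D E] (ρ : CStarRep C₀(ℝ, ℂ) D E)

/-- Linearity in `p` reduces to monomials. Constants act on every vector, so positive powers
suffice. -/
theorem exists_mem_multGraph_of_pow {x : E}
    (h : ∀ n : ℕ, ∃ y, (x, y) ∈ ρ.multGraph (Polynomial.X ^ (n + 1))) (p : ℂ[X]) :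
    ∃ y, (x, y) ∈ ρ.multGraph p := by
  induction p using Polynomial.induction_on' with
  | add p q hp hq =>
    obtain ⟨y, hy⟩ := hp
    obtain ⟨z, hz⟩ := hq
    exact ⟨_, ρ.multGraph_add hy hz⟩
  | monomial n c =>
    rw [← Polynomial.smul_X_eq_monomial]
    have : ∃ y, (x, y) ∈ ρ.multGraph (Polynomial.X ^ n) := by
      cases n with
      | zero => exact ⟨x, by rw [pow_zero, mem_multGraph_one]⟩
      | succ n => exact h n
    obtain ⟨y, hy⟩ := this
    exact ⟨_, ρ.multGraph_smul c hy⟩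

theorem induced_dom_eq {t : E →ₗ.[ℂ] E} (ht : t.graph = ρ.multGraph Polynomial.X) :
    (muRep.induced ρ).dom = ⨅ n : ℕ, (HilbertModule.powOp t (n + 1)).domain := by
  ext x
  rw [mem_induced_dom, Submodule.mem_iInf]
  simp only [LinearPMap.mem_domain_iff, ρ.graph_powOp_of_graph_eq ht]
  exact ⟨fun h n => h _, ρ.exists_mem_multGraph_of_pow⟩

variable {ρ} {P : UnboundedRep ℂ[X] D E}

/-- `X` generates `ℂ[X]`, and the relations `multGraph` are compatible with sums, scalars and
products. So `P` is a restriction of `Φ(ρ)` as soon as this holds for the operator of `X`. -/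
theorem rep_mem_multGraph (h : (P.op Polynomial.X).graph ≤ ρ.multGraph Polynomial.X) (x : P.dom)
    (p : ℂ[X]) : ((x : E), (P.π p x : E)) ∈ ρ.multGraph p := by
  induction p using Polynomial.induction_on' with
  | add p q hp hq =>
    rw [map_add]
    exact ρ.multGraph_add hp hq
  | monomial n c =>
    rw [← Polynomial.smul_X_eq_monomial, map_smul]
    refine ρ.multGraph_smul c ?_
    induction n with
    | zero => simp [mem_multGraph_one]
    | succ n ih =>
      rw [pow_succ]
      refine ρ.multGraph_mul ih ?_
      rw [← pow_succ, pow_succ', map_mul]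
      exact h (P.mem_op_graph _ _)

theorem eq_induced_of_dom_le (h : (P.op Polynomial.X).graph ≤ ρ.multGraph Polynomial.X)
    (hdom : (muRep.induced ρ).dom ≤ P.dom) : P = muRep.induced ρ := by
  refine UnboundedRep.ext_graph (le_antisymm ?_ ?_)
  · rintro _ ⟨x, rfl⟩
    rw [mem_range_graphMap_induced, UnboundedRep.graphMap_one]
    exact rep_mem_multGraph h x
  · rintro _ ⟨x, rfl⟩
    refine ⟨⟨x, hdom x.2⟩, funext fun p => ?_⟩
    exact ρ.multGraph_unique (rep_mem_multGraph h _ p) (ρ.mem_induced_graph x.2 p)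

/-- If the closures of `π (X ^ n)` are the operators induced by the functions `t ↦ t ^ n`, then a
closed representation `π` is induced by `ρ`. -/
theorem eq_induced_of_closure [CompleteSpace E] (hP : P.IsClosed)
    (h : ∀ n : ℕ, (P.op (Polynomial.X ^ n)).closure.graph = ρ.multGraph (Polynomial.X ^ n)) :
    P = muRep.induced ρ := by
  have hX : (P.op Polynomial.X).graph ≤ ρ.multGraph Polynomial.X := by
    have := h 1
    rw [pow_one] at this
    rw [← this]
    exact LinearPMap.le_graph_of_le (LinearPMap.le_closure _)
  refine eq_induced_of_dom_le hX fun x hx => ?_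
  obtain ⟨v, hv, rfl⟩ := (UnboundedRep.mem_dom_iff _ _).1 hx
  rw [mem_range_graphMap_induced] at hv
  -- A diagonal choice: the `N`-th vector approximates only in the graph norm of `X ^ N`, with error
  -- tending to `0`.
  have happrox (N : ℕ) : ∃ y : P.dom, ‖(y : E) - v 1‖ ≤ 1 / ((N : ℝ) + 1) ∧
      ‖(P.π (Polynomial.X ^ N) y : E) - v (Polynomial.X ^ N)‖ ≤ 1 / ((N : ℝ) + 1) := by
    have h1 : (v 1, v (Polynomial.X ^ N)) ∈ (P.op (Polynomial.X ^ N)).graph.topologicalClosure := by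
      rw [← UnboundedRep.graph_closure_op, h]
      exact hv _
    obtain ⟨z, hz, hd⟩ := Metric.mem_closure_iff.1 h1 (1 / ((N : ℝ) + 1)) (by positivity)
    obtain ⟨y, rfl⟩ := (P.mem_op_graph_iff _ _).1 hz
    rw [dist_comm, dist_eq_norm] at hd
    exact ⟨y, (norm_fst_le _).trans hd.le, (norm_snd_le _).trans hd.le⟩
  choose y hy1 hy2 using happrox
  have hlim (p : ℂ[X]) : Tendsto (fun N => (P.π p (y N) : E)) atTop (𝓝 (v p)) := by
    have hmem (p : ℂ[X]) (N : ℕ) : ((y N : E) - v 1, (P.π p (y N) : E) - v p) ∈ ρ.multGraph p :=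
      (ρ.multGraph p).sub_mem (rep_mem_multGraph hX (y N) p) (hv p)
    induction p using Polynomial.induction_on' with
    | add p q hp hq =>
      have h1 : v (p + q) = v p + v q := ρ.multGraph_unique (hv _) (ρ.multGraph_add (hv p) (hv q))
      rw [h1]
      exact (hp.add hq).congr fun N => by rw [map_add]; rfl
    | monomial k c =>
      rw [← Polynomial.smul_X_eq_monomial]
      have h1 : v (c • Polynomial.X ^ k) = c • v (Polynomial.X ^ k) :=
        ρ.multGraph_unique (hv _) (ρ.multGraph_smul c (hv _))
      rw [h1]
      simp only [map_smul]
      refine Tendsto.const_smul ?_ c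
      rw [tendsto_iff_norm_sub_tendsto_zero]
      have h2 : Tendsto (fun N : ℕ => 1 / ((N : ℝ) + 1) + 1 / ((N : ℝ) + 1)) atTop (𝓝 0) := by
        simpa using tendsto_one_div_add_atTop_nhds_zero_nat.add
          (tendsto_one_div_add_atTop_nhds_zero_nat (𝕜 := ℝ))
      refine squeeze_zero' (Eventually.of_forall fun _ => norm_nonneg _) ?_ h2
      -- Once `N > k`, the error for `X ^ k` is a combination of the errors for `1` and `X ^ N` with
      -- contractive coefficients.
      filter_upwards [eventually_gt_atTop k] with N hN
      rw [ρ.multGraph_unique (hmem _ N) (ρ.mem_multGraph_pow_of_lt hN (hmem _ N))]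
      refine (norm_add_le _ _).trans (add_le_add ?_ ?_)
      · refine (ρ.norm_map_le _ _).trans (le_trans ?_ (hy1 N))
        exact mul_le_of_le_one_left (norm_nonneg _) (norm_powDiv_le _ _ _)
      · refine (ρ.norm_map_le _ _).trans (le_trans ?_ (hy2 N))
        exact mul_le_of_le_one_left (norm_nonneg _) (norm_powDiv_le _ _ _)
  have hv' : v ∈ LinearMap.range P.graphMap := by
    have hclosed := P.isClosed_iff_isClosed_range.1 hP
    exact hclosed.mem_of_tendsto (b := atTop) (f := fun N => P.graphMap (y N))
      (tendsto_pi_nhds.2 hlim) (Eventually.of_forall fun N => ⟨y N, rfl⟩)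
  exact (P.mem_dom_iff _).2 ⟨v, hv', rfl⟩

end CStarRep

/-! ### The equivalences and the C*-hull. -/

theorem UnboundedRep.isIntegrable_induced {D : Type u} {E : Type v} [NonUnitalCStarAlgebra D]
    [NormedAddCommGroup E] [NormedSpace ℂ E] [HilbertModule D E] (ρ : CStarRep C₀(ℝ, ℂ) D E) :
    (muRep.induced ρ).IsIntegrable := fun a ha =>
  ⟨ρ.isRegular_of_graph_eq (ρ.graph_closure_induced_op a),
    ρ.isSelfAdjointOp_of_graph_eq (ρ.graph_closure_induced_op a) ha⟩

theorem Polynomial.isSelfAdjoint_X_pow (n : ℕ) : IsSelfAdjoint (X ^ n : ℂ[X]) := by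
  change Polynomial.map _ _ = _
  simp

/-- The equivalent characterisations of integrable representations of `ℂ[X]`. -/
theorem UnboundedRep.tfae_isIntegrable {D : Type u} {E : Type v} [NonUnitalCStarAlgebra D]
    [NormedAddCommGroup E] [NormedSpace ℂ E] [CompleteSpace E] [HilbertModule D E]
    (P : UnboundedRep ℂ[X] D E) (hP : P.IsClosed) :
    List.TFAE [
      ∃ ρ : CStarRep C₀(ℝ, ℂ) D E, P = muRep.induced ρ,
      ∀ a : ℂ[X], IsSelfAdjoint a →
        HilbertModule.IsRegular D (P.op a).closure ∧
        HilbertModule.IsSelfAdjointOp D (P.op a).closure,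
      ∀ n : ℕ, HilbertModule.IsRegular D (P.op (Polynomial.X ^ n)).closure ∧
        HilbertModule.IsSelfAdjointOp D (P.op (Polynomial.X ^ n)).closure,
      HilbertModule.IsRegular D (P.op Polynomial.X).closure ∧
        HilbertModule.IsSelfAdjointOp D (P.op Polynomial.X).closure ∧
        ∀ n : ℕ, (P.op (Polynomial.X ^ n)).closure
          = HilbertModule.powOp (P.op Polynomial.X).closure n,
      HilbertModule.IsRegular D (P.op Polynomial.X).closure ∧
        HilbertModule.IsSelfAdjointOp D (P.op Polynomial.X).closure ∧
        P.dom = ⨅ n : ℕ, (HilbertModule.powOp (P.op Polynomial.X).closure (n + 1)).domain] := by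
  have hle {ρ : CStarRep C₀(ℝ, ℂ) D E}
      (h : (P.op Polynomial.X).closure.graph = ρ.multGraph Polynomial.X) :
      (P.op Polynomial.X).graph ≤ ρ.multGraph Polynomial.X :=
    h ▸ LinearPMap.le_graph_of_le (LinearPMap.le_closure _)
  tfae_have 1 → 2 := by
    rintro ⟨ρ, rfl⟩
    exact isIntegrable_induced ρ
  tfae_have 2 → 3 := fun h n => h _ (Polynomial.isSelfAdjoint_X_pow n)
  tfae_have 3 → 1 := by
    intro h
    have h1 := h 1
    rw [pow_one] at h1
    obtain ⟨ρ, hρ⟩ := CStarRep.exists_multGraph_eq h1.1 h1.2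
    refine ⟨ρ, CStarRep.eq_induced_of_closure hP fun n => ?_⟩
    have hsub : (P.op (Polynomial.X ^ n)).closure.graph ≤ ρ.multGraph (Polynomial.X ^ n) := by
      rw [graph_closure_op]
      refine Submodule.topologicalClosure_minimal _ (fun z hz => ?_) (ρ.isClosed_multGraph _)
      obtain ⟨x, rfl⟩ := (P.mem_op_graph_iff _ _).1 hz
      exact CStarRep.rep_mem_multGraph (hle hρ) x _
    refine le_antisymm hsub ?_
    rintro ⟨y, z⟩ hyz
    -- A self-adjoint operator contained in a self-adjoint operator equals it: symmetry of the
    -- larger one puts its graph inside the adjoint of the smaller one.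
    have hsa := (h n).2
    have hM := (isIntegrable_induced ρ _ (Polynomial.isSelfAdjoint_X_pow n)).2
    rw [← hsa.2, HilbertModule.mem_adjoint_graph D _ hsa.1]
    intro x
    have hx := hsub (LinearPMap.mem_graph _ x)
    rw [← ρ.graph_closure_induced_op] at hx hyz
    exact hM.inner_eq hx hyz
  tfae_have 1 → 4 := by
    rintro ⟨ρ, rfl⟩
    have h := ρ.graph_closure_induced_op Polynomial.X
    refine ⟨ρ.isRegular_of_graph_eq h, ρ.isSelfAdjointOp_of_graph_eq h ?_, fun n => ?_⟩
    · simpa using Polynomial.isSelfAdjoint_X_pow 1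
    · apply LinearPMap.eq_of_eq_graph
      rw [ρ.graph_closure_induced_op, ρ.graph_powOp_of_graph_eq h]
  tfae_have 4 → 1 := by
    rintro ⟨h1, h2, h3⟩
    obtain ⟨ρ, hρ⟩ := CStarRep.exists_multGraph_eq h1 h2
    refine ⟨ρ, CStarRep.eq_induced_of_closure hP fun n => ?_⟩
    rw [h3, ρ.graph_powOp_of_graph_eq hρ]
  tfae_have 1 → 5 := by
    rintro ⟨ρ, rfl⟩
    have h := ρ.graph_closure_induced_op Polynomial.X
    refine ⟨ρ.isRegular_of_graph_eq h, ρ.isSelfAdjointOp_of_graph_eq h ?_, ρ.induced_dom_eq h⟩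
    simpa using Polynomial.isSelfAdjoint_X_pow 1
  tfae_have 5 → 1 := by
    rintro ⟨h1, h2, h3⟩
    obtain ⟨ρ, hρ⟩ := CStarRep.exists_multGraph_eq h1 h2
    refine ⟨ρ, CStarRep.eq_induced_of_dom_le (hle hρ) ?_⟩
    rw [ρ.induced_dom_eq hρ, ← h3]
  tfae_finish

theorem mainTheorem4 :
    (∀ (D : Type u) (E : Type v) [NonUnitalCStarAlgebra D] [NormedAddCommGroup E]
      [NormedSpace ℂ E] [CompleteSpace E] [HilbertModule D E] (P : UnboundedRep ℂ[X] D E),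
      P.IsClosed →
      List.TFAE [
        ∃ ρ : CStarRep C₀(ℝ, ℂ) D E, P = muRep.induced ρ,
        ∀ a : ℂ[X], IsSelfAdjoint a →
          HilbertModule.IsRegular D (P.op a).closure ∧
          HilbertModule.IsSelfAdjointOp D (P.op a).closure,
        ∀ n : ℕ, HilbertModule.IsRegular D (P.op (Polynomial.X ^ n)).closure ∧
          HilbertModule.IsSelfAdjointOp D (P.op (Polynomial.X ^ n)).closure,
        HilbertModule.IsRegular D (P.op Polynomial.X).closure ∧
          HilbertModule.IsSelfAdjointOp D (P.op Polynomial.X).closure ∧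
          ∀ n : ℕ, (P.op (Polynomial.X ^ n)).closure
            = HilbertModule.powOp (P.op Polynomial.X).closure n,
        HilbertModule.IsRegular D (P.op Polynomial.X).closure ∧
          HilbertModule.IsSelfAdjointOp D (P.op Polynomial.X).closure ∧
          P.dom = ⨅ n : ℕ, (HilbertModule.powOp (P.op Polynomial.X).closure (n + 1)).domain]) ∧
    IsCStarHull ℂ[X] C₀(ℝ, ℂ) (fun (D : Type u) (E : Type v) _ _ _ _ _ P => P.IsIntegrable)
      (fun (D : Type u) (E : Type v) _ _ _ _ _ ρ => muRep.induced ρ) ∧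
    muRep.induced (CStarRep.self C₀(ℝ, ℂ)) = muRep := by
  refine ⟨fun D E _ _ _ _ _ P hP => P.tfae_isIntegrable hP, ?_, CStarRep.induced_self⟩
  constructor
  · intro D E _ _ _ _ _
    refine ⟨fun ρ _ => ⟨ρ.isClosed_induced, UnboundedRep.isIntegrable_induced ρ⟩,
      CStarRep.injective_induced.injOn, fun P hP => ?_⟩
    obtain ⟨ρ, rfl⟩ := ((P.tfae_isIntegrable hP.1).out 0 1).2 hP.2
    exact ⟨ρ, trivial, rfl⟩
  · intro D E₁ E₂ _ _ _ _ _ _ _ _ _ ρ₁ ρ₂ I hI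
    exact CStarRep.intertwines_iff ρ₁ ρ₂ hI
  · intro D₁ D₂ E F T _ _ _ _ _ _ _ _ _ _ _ _ _ _ φ τ h ρ
    exact ⟨ρ.tensor h, ρ.tensor_tmul h, CStarRep.induced_tensor h ρ⟩
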